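/- A permutation of length $n$ is a bijection of $[n]=\{1,\dots,n\}$. It contains $\sigma$ (of length $k$) as a subpermutation if there are $i_1<\dots<i_k$ such that $\pi(i_j)<\pi(i_\ell)\iff\sigma(j)<\sigma(\ell)$. Let $\mathcal P$ be a hereditary family of permutations (closed under subpermutations) that is proper, i.e. not all permutations are in $\mathcal P$, and contains at least one permutation of positive length. Let $\sigma$ be a shortest permutation not in $\mathcal P$, and let $c(\sigma)=\lim_{n\to\infty}\mathrm{ex}(n,\sigma)/n$ be its Füredi–Hajnal constant, where $\mathrm{ex}(n,\sigma)$ is the maximum number of ones in an $n\times n$ $0$-$1$ matrix that does not contain the permutation matrix of $\sigma$ (i.e. has no submatrix of the size of that matrix with a one wherever that matrix has a one). A blow-up of $\alpha$ is obtained by replacing the points of $\alpha$ by nonempty blocks, such that each block is an interval of positions and points in different blocks compare as the corresponding points of $\alpha$; the order within a block is arbitrary. In a $k$-blow-up every block has size $k$. Let $k^*(\alpha)$ be the least positive integer $k$ such that no $k$-blow-up of $\alpha$ is in $\mathcal P$ ($\infty$ if there is none), and let $k^*(T)$ be the maximum of the finite values $k^*(\alpha)$ over all $\alpha$ of length $T$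 ($\infty$ if there is no finite value). For permutations of length $n$ let $$\rho_{\mathrm{EMD}}(\pi_1,\pi_2)=\frac1{\binom n2}\min_{\theta}\sum_{i=1}^n\bigl(|i-\theta(i)|+|\pi_1(i)-\pi_2(\theta(i))|\bigr),$$ with the minimum over all bijections $\theta:[n]\to[n]$, and let $\rho_{\mathrm{PT}}(\pi_1,\pi_2)$ (planar tau distance) be $\binom n2^{-1}$ times the least number of swaps of the values at two adjacent positions or of the positions of two adjacent values that transform $\pi_1$ into $\pi_2$. For each of these metrics, the distance from $\pi$ to $\mathcal P$ is the minimum of the distances from $\pi$ to the elements of $\mathcal P$ of the same length, or $1$ if there are none. The blow-up tester with $M$ queries picks a uniformly random set of $M$ positions of $\pi$; let $\pi'$ be the induced subpermutation. It outputs "$\pi$ is in $\mathcal P$" if for every positive integer $k$ some $k$-blow-up of $\pi'$ is in $\mathcal P$, and "$\pi$ is not in $\mathcal P$" otherwise. **Theorem.** The limit $c(\sigma)$ exists. Let $0<\varepsilon\le1$ and let $M$ be an integer with $$M\ \ge\ \frac{2000\,c(\sigma)\,\log_2^2(2/\varepsilon)}{\varepsilon}$$ (for instance the least such integer). Then $M\ge|\sigma|$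 and $k^*(M)$ is finite, and for every permutation $\pi$ of length $n\ge 32M^5k^*(M)/\varepsilon^3$ the following holds for the blow-up tester with $M$ queries. 1. If $\pi\in\mathcal P$, then with probability at least $1-\varepsilon$ it outputs "$\pi$ is in $\mathcal P$". 2. If the earth mover's distance from $\pi$ to $\mathcal P$ is greater than $\varepsilon$, then with probability at least $1-\varepsilon$ it outputs "$\pi$ is not in $\mathcal P$". The same holds if the planar tau distance from $\pi$ to $\mathcal P$ is greater than $\varepsilon$. -/

import Mathlib

open Filter Topology

noncomputable section

/-- A permutation property: for each length `n`, a set of permutations of length `n`.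
Positions and values are indexed by `Fin n`, that is, `0, …, n - 1`. -/
abbrev PermProperty : Type := ∀ n : ℕ, Set (Equiv.Perm (Fin n))

/-- `σ` is a subpermutation of `π`: some subsequence of `π` has the order type of `σ`. -/
def IsSubpermutation {k n : ℕ} (σ : Equiv.Perm (Fin k)) (π : Equiv.Perm (Fin n)) : Prop :=
  ∃ f : Fin k ↪o Fin n, ∀ i j, π (f i) < π (f j) ↔ σ i < σ j

/-- A property is hereditary if it is closed under taking subpermutations. -/
def PermProperty.Hereditary (P : PermProperty) : Prop :=
  ∀ (k n : ℕ) (σ : Equiv.Perm (Fin k)) (π : Equiv.Perm (Fin n)),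
    π ∈ P n → IsSubpermutation σ π → σ ∈ P k

/-- `σ` is a smallest forbidden permutation of `P`: it is not in `P`, and every permutation
that is not in `P` is at least as long. -/
def IsSmallestForbidden (P : PermProperty) {s : ℕ} (σ : Equiv.Perm (Fin s)) : Prop :=
  σ ∉ P s ∧ ∀ (r : ℕ) (τ : Equiv.Perm (Fin r)), τ ∉ P r → s ≤ r

section FurediHajnal

/-- The 0-1 matrix `A` contains the 0-1 matrix `B`: `A` has a submatrix of the size of `B`
with a one wherever `B` has a one. -/
def MatrixContains {n k : ℕ} (A : Matrix (Fin n) (Fin n) Bool) (B : Matrix (Fin k) (Fin k) Bool) :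
    Prop :=
  ∃ r c : Fin k ↪o Fin n, ∀ i j, B i j = true → A (r i) (c j) = true

/-- The permutation matrix of `σ`, as a 0-1 matrix. -/
def permZeroOneMatrix {k : ℕ} (σ : Equiv.Perm (Fin k)) : Matrix (Fin k) (Fin k) Bool :=
  fun i j => decide (σ i = j)

/-- The number of one entries of a 0-1 matrix. -/
def numOnes {n : ℕ} (A : Matrix (Fin n) (Fin n) Bool) : ℕ :=
  (Finset.univ.filter fun p : Fin n × Fin n => A p.1 p.2 = true).card

open Classical in
/-- The extremal number `ex(n, σ)`: the maximum number of ones in an `n × n` matrix with entries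
`0` or `1` that does not contain the permutation matrix of `σ`. -/
def exNumber {k : ℕ} (n : ℕ) (σ : Equiv.Perm (Fin k)) : ℕ :=
  ((Finset.univ : Finset (Fin n → Fin n → Bool)).filter
    fun A => ¬ MatrixContains (n := n) A (permZeroOneMatrix σ)).sup (numOnes (n := n))

/-- The Füredi–Hajnal constant `c(σ) = lim ex(n, σ) / n`. -/
def furediHajnal {k : ℕ} (σ : Equiv.Perm (Fin k)) : ℝ :=
  limUnder atTop fun n : ℕ => (exNumber n σ : ℝ) / n

end FurediHajnal

section BlowUp

/-- `β` is a blow-up of `α` with block boundaries `t`: block `j` of `β` consists of the positions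
`i` with `t j ≤ i < t (j + 1)`, it is nonempty, and points of `β` in different blocks compare as
the corresponding points of `α`. -/
def IsBlowUpWith {m N : ℕ} (α : Equiv.Perm (Fin m)) (β : Equiv.Perm (Fin N))
    (t : Fin (m + 1) → ℕ) : Prop :=
  StrictMono t ∧ t 0 = 0 ∧ t (Fin.last m) = N ∧
    ∀ (j₁ j₂ : Fin m) (i₁ i₂ : Fin N), j₁ ≠ j₂ →
      t j₁.castSucc ≤ i₁ → (i₁ : ℕ) < t j₁.succ →
      t j₂.castSucc ≤ i₂ → (i₂ : ℕ) < t j₂.succ →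
      (β i₂ < β i₁ ↔ α j₂ < α j₁)

/-- `β` is a `k`-blow-up of `α`: a blow-up in which every block has size `k`. -/
def IsKBlowUp {m N : ℕ} (k : ℕ) (α : Equiv.Perm (Fin m)) (β : Equiv.Perm (Fin N)) : Prop :=
  ∃ t : Fin (m + 1) → ℕ, IsBlowUpWith α β t ∧ ∀ j : Fin m, t j.succ = t j.castSucc + k

/-- Some `k`-blow-up of `α` is in `P`. -/
def HasKBlowUpIn (P : PermProperty) {m : ℕ} (k : ℕ) (α : Equiv.Perm (Fin m)) : Prop :=
  ∃ (N : ℕ) (β : Equiv.Perm (Fin N)), IsKBlowUp k α β ∧ β ∈ P N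

/-- The blow-up parameter `k*(α)` of a permutation: the least positive integer `k` such that no
`k`-blow-up of `α` is in `P`, and `∞` if there is none. -/
def kStarPerm (P : PermProperty) {m : ℕ} (α : Equiv.Perm (Fin m)) : ℕ∞ :=
  ⨅ (k : ℕ) (_ : 0 < k ∧ ¬ HasKBlowUpIn P k α), (k : ℕ∞)

open Classical in
/-- The blow-up parameter `k*(T)`: the maximum of the finite values `k*(α)` over the permutations
`α` of length `T`, and `∞` if there is no finite value. -/
def kStar (P : PermProperty) (T : ℕ) : ℕ∞ :=
  if ∃ α : Equiv.Perm (Fin T), kStarPerm P α < ⊤ then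
    ⨆ (α : Equiv.Perm (Fin T)) (_ : kStarPerm P α < ⊤), kStarPerm P α
  else ⊤

end BlowUp

section Metrics

/-- The earth mover's distance between two permutations of length `n`. -/
def earthMoverDist {n : ℕ} (π₁ π₂ : Equiv.Perm (Fin n)) : ℝ :=
  1 / (n.choose 2 : ℝ) * ⨅ θ : Equiv.Perm (Fin n),
    ∑ i : Fin n, (|((i : ℕ) : ℝ) - ((θ i : ℕ) : ℝ)| +
      |((π₁ i : ℕ) : ℝ) - ((π₂ (θ i) : ℕ) : ℝ)|)

/-- `ρ` is obtained from `π` by a planar simple transposition: by swapping the values at two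
adjacent positions, or by swapping the positions of two adjacent values. -/
def PlanarStep {n : ℕ} (π ρ : Equiv.Perm (Fin n)) : Prop :=
  ∃ i j : Fin n, (i : ℕ) + 1 = (j : ℕ) ∧
    (ρ = π * Equiv.swap i j ∨ ρ = Equiv.swap i j * π)

/-- The least number of planar simple transpositions that transform `π₁` into `π₂`. -/
def planarSteps {n : ℕ} (π₁ π₂ : Equiv.Perm (Fin n)) : ℕ :=
  sInf {m : ℕ | ∃ p : ℕ → Equiv.Perm (Fin n),
    p 0 = π₁ ∧ p m = π₂ ∧ ∀ t < m, PlanarStep (p t) (p (t + 1))}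

/-- The planar tau distance between two permutations of length `n`. -/
def planarTauDist {n : ℕ} (π₁ π₂ : Equiv.Perm (Fin n)) : ℝ :=
  1 / (n.choose 2 : ℝ) * (planarSteps π₁ π₂ : ℝ)

open Classical in
/-- The distance from `π` to `P` with respect to `d`: the minimum of `d π π₀` over the `π₀ ∈ P` of
the same length as `π`, and `1` if there is no such `π₀`. -/
def distToProperty {n : ℕ} (d : Equiv.Perm (Fin n) → Equiv.Perm (Fin n) → ℝ) (P : PermProperty)
    (π : Equiv.Perm (Fin n)) : ℝ :=
  if (P n).Nonempty then ⨅ π₀ : P n, d π π₀ else 1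

end Metrics

section Tester

/-- The subpermutation of `π` induced on a set `S` of `M` positions. -/
def inducedPerm {n M : ℕ} (π : Equiv.Perm (Fin n)) (S : Finset (Fin n)) (hS : S.card = M) :
    Equiv.Perm (Fin M) :=
  (S.orderIsoOfFin hS).toEquiv.trans <|
    (π.subtypeEquiv (p := (· ∈ S)) (q := (· ∈ S.map π.toEmbedding)) (fun a => by simp)).trans
      ((S.map π.toEmbedding).orderIsoOfFin ((Finset.card_map _).trans hS)).symm.toEquiv

/-- The induced subpermutation has the order type of `π` on `S`. -/
theorem inducedPerm_lt_iff {n M : ℕ} (π : Equiv.Perm (Fin n)) (S : Finset (Fin n))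
    (hS : S.card = M) (i j : Fin M) :
    inducedPerm π S hS i < inducedPerm π S hS j ↔
      π (S.orderEmbOfFin hS i) < π (S.orderEmbOfFin hS j) := by
  simp [inducedPerm]

/-- The decision rule of the blow-up tester, a function of the sampled permutation `α` alone:
accept if and only if for every positive integer `k` some `k`-blow-up of `α` is in `P`. -/
def TesterAccepts (P : PermProperty) {M : ℕ} (α : Equiv.Perm (Fin M)) : Prop :=
  ∀ k : ℕ, 0 < k → HasKBlowUpIn P k α

/-- The probability of the event `E` about the induced subpermutation `π'` of `π` on a uniformly
random set of `M` positions. -/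
def sampleProb {n : ℕ} (M : ℕ) (π : Equiv.Perm (Fin n)) (E : Equiv.Perm (Fin M) → Prop) : ℝ :=
  (Nat.card {S : {S : Finset (Fin n) // S.card = M} // E (inducedPerm π S.1 S.2)} : ℝ) /
    (Nat.card {S : Finset (Fin n) // S.card = M} : ℝ)

end Tester

end

/-! Rejecting far permutations. An accepted sample lies in `P`, so it avoids `σ`. In a `2^i × 2^i`
grid on the points of `π`, the cells hit by the sample then form a matrix avoiding `σ`, so at most
`ex(2^i, σ) ≤ c(σ) 2^i` cells are hit. While more than a `δ`-fraction of the points lies in unhit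
cells, each query hits a new cell with probability at least `δ`. With `M` queries, too few hit cells
together with a large uncovered part is therefore exponentially unlikely (`card_uncovered_gt_le`).
Hence, at every scale, almost all points share a cell with a sample point. Summing over scales, the
points can be moved to sample points at small total cost (`exists_mem_near`, `sum_dist_le`).
Acceptance supplies an `n`-blow-up of the sample in `P`; keeping in each block as many points as
were moved there gives a nearby member of `P` (`exists_mem_earthMoverDist_le`). The planar tau
distance is at most the earth mover's distance, by sorting positions and then values.

Accepting members. In a grid with about `4M²/ε` rows and columns, the sample points probably lie in
distinct rows and columns and in cells with at least `k*(M)` points. Choosing `k ≤ k*(M)` points in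
each of these cells of `π ∈ P` gives a `k`-blow-up of the sample in `P`, so the sample cannot be a
rejected one.

The bound `ex(n, σ) ≤ c(σ) n` for every `n`, not just asymptotically, comes from Fekete's lemma:
diagonal sums make `ex` superadditive, and the Marcus–Tardos block argument makes it linear. -/

/-! ### Superadditivity of the extremal number. -/

theorem matrixContains_perm_iff {n k : ℕ} (A : Matrix (Fin n) (Fin n) Bool)
    (σ : Equiv.Perm (Fin k)) :
    MatrixContains A (permZeroOneMatrix σ) ↔
      ∃ r c : Fin k → Fin n, StrictMono r ∧ StrictMono c ∧ ∀ i, A (r i) (c (σ i)) = true := by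
  constructor
  · rintro ⟨r, c, h⟩
    exact ⟨r, c, r.strictMono, c.strictMono, fun i => h i (σ i) (by simp [permZeroOneMatrix])⟩
  · rintro ⟨r, c, hr, hc, h⟩
    refine ⟨OrderEmbedding.ofStrictMono r hr, OrderEmbedding.ofStrictMono c hc, fun i j hij => ?_⟩
    have : σ i = j := by simpa [permZeroOneMatrix] using hij
    subst this
    exact h i

theorem numOnes_le_exNumber {n k : ℕ} {σ : Equiv.Perm (Fin k)} {A : Matrix (Fin n) (Fin n) Bool}
    (h : ¬ MatrixContains A (permZeroOneMatrix σ)) : numOnes A ≤ exNumber n σ := by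
  classical
  unfold exNumber
  exact Finset.le_sup (f := numOnes (n := n)) (Finset.mem_filter.2 ⟨Finset.mem_univ _, h⟩)

theorem exNumber_le {n k : ℕ} {σ : Equiv.Perm (Fin k)} {b : ℕ}
    (h : ∀ A : Matrix (Fin n) (Fin n) Bool, ¬ MatrixContains A (permZeroOneMatrix σ) →
      numOnes A ≤ b) : exNumber n σ ≤ b := by
  classical
  unfold exNumber
  exact Finset.sup_le fun A hA => h A (Finset.mem_filter.1 hA).2

theorem exists_numOnes_eq_exNumber {k : ℕ} (hk : 0 < k) (n : ℕ) (σ : Equiv.Perm (Fin k)) :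
    ∃ A : Matrix (Fin n) (Fin n) Bool, ¬ MatrixContains A (permZeroOneMatrix σ) ∧
      numOnes A = exNumber n σ := by
  classical
  obtain ⟨A, hA, h⟩ := Finset.exists_mem_eq_sup
    ((Finset.univ : Finset (Fin n → Fin n → Bool)).filter
      fun A => ¬ MatrixContains (n := n) A (permZeroOneMatrix σ))
    ⟨fun _ _ => false, Finset.mem_filter.2 ⟨Finset.mem_univ _, fun h => by
      obtain ⟨r, c, -, -, h⟩ := (matrixContains_perm_iff _ _).1 h
      exact Bool.false_ne_true (h ⟨0, hk⟩)⟩⟩ (numOnes (n := n))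
  refine ⟨A, (Finset.mem_filter.1 hA).2, h.symm.trans ?_⟩
  unfold exNumber
  congr!

theorem numOnes_eq_sum {n : ℕ} (A : Matrix (Fin n) (Fin n) Bool) :
    numOnes A = ∑ i, ∑ j, if A i j = true then 1 else 0 := by
  rw [numOnes, Finset.card_filter, ← Finset.univ_product_univ, Finset.sum_product]

/-- The block diagonal 0-1 matrix with blocks `A` and `B`. -/
def boolDirectSum {a b : ℕ} (A : Matrix (Fin a) (Fin a) Bool) (B : Matrix (Fin b) (Fin b) Bool) :
    Matrix (Fin (a + b)) (Fin (a + b)) Bool :=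
  fun i j => Fin.addCases (fun i' => Fin.addCases (fun j' => A i' j') (fun _ => false) j)
    (fun i' => Fin.addCases (fun _ => false) (fun j' => B i' j') j) i

theorem numOnes_boolDirectSum {a b : ℕ} (A : Matrix (Fin a) (Fin a) Bool)
    (B : Matrix (Fin b) (Fin b) Bool) :
    numOnes (boolDirectSum A B) = numOnes A + numOnes B := by
  simp [numOnes_eq_sum, boolDirectSum, Fin.sum_univ_add]

theorem boolDirectSum_eq_true {a b : ℕ} {A : Matrix (Fin a) (Fin a) Bool}
    {B : Matrix (Fin b) (Fin b) Bool} {i j : Fin (a + b)} (h : boolDirectSum A B i j = true) :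
    (∃ i' j', i = Fin.castAdd b i' ∧ j = Fin.castAdd b j' ∧ A i' j' = true) ∨
      (∃ i' j', i = Fin.natAdd a i' ∧ j = Fin.natAdd a j' ∧ B i' j' = true) := by
  induction i using Fin.addCases <;> induction j using Fin.addCases <;>
    simp_all [boolDirectSum]

/-- A copy of `σ` meeting both blocks has its first row in `A` and its last row in `B`, so the
column of `σ 0` precedes that of `σ (Fin.last k)`, against `hσ`. Every copy thus lies in one block.
-/
theorem not_matrixContains_boolDirectSum {a b k : ℕ} {σ : Equiv.Perm (Fin (k + 1))}
    (hσ : σ (Fin.last k) < σ 0) {A : Matrix (Fin a) (Fin a) Bool} {B : Matrix (Fin b) (Fin b) Bool}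
    (hA : ¬ MatrixContains A (permZeroOneMatrix σ))
    (hB : ¬ MatrixContains B (permZeroOneMatrix σ)) :
    ¬ MatrixContains (boolDirectSum A B) (permZeroOneMatrix σ) := by
  rw [matrixContains_perm_iff] at *
  rintro ⟨r, c, hr, hc, h⟩
  have key := fun i => boolDirectSum_eq_true (h i)
  rcases lt_or_ge (r (Fin.last k) : ℕ) a with h1 | h1
  · apply hA
    have : ∀ i, ∃ i' j', r i = Fin.castAdd b i' ∧ c (σ i) = Fin.castAdd b j' ∧ A i' j' = true := by
      intro i
      rcases key i with h2 | ⟨i', j', h2, -⟩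
      · exact h2
      · have h3 : (r i : ℕ) ≤ r (Fin.last k) := hr.monotone (Fin.le_last i)
        rw [h2] at h3
        simp at h3
        omega
    choose r' c' h1 h2 h3 using this
    refine ⟨r', c' ∘ σ.symm, fun i j hij => ?_, fun i j hij => ?_, fun i => by simpa using h3 i⟩
    · have := hr hij
      rw [h1, h1] at this
      exact this
    · have := hc hij
      have e1 := h2 (σ.symm i)
      have e2 := h2 (σ.symm j)
      simp only [Equiv.apply_symm_apply] at e1 e2
      rw [e1, e2] at this
      exact this
  rcases lt_or_ge (r 0 : ℕ) a with h0 | h0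
  · have c0 : (c (σ 0) : ℕ) < a := by
      rcases key 0 with ⟨i', j', -, h2, -⟩ | ⟨i', j', h2, -⟩
      · rw [h2]; simp
      · rw [h2] at h0; simp at h0
    have c1 : a ≤ (c (σ (Fin.last k)) : ℕ) := by
      rcases key (Fin.last k) with ⟨i', j', h2, -⟩ | ⟨i', j', -, h2, -⟩
      · rw [h2] at h1; simp at h1; omega
      · rw [h2]; simp
    have : (c (σ (Fin.last k)) : ℕ) < c (σ 0) := hc hσ
    omega
  · apply hB
    have : ∀ i, ∃ i' j', r i = Fin.natAdd a i' ∧ c (σ i) = Fin.natAdd a j' ∧ B i' j' = true := by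
      intro i
      rcases key i with ⟨i', j', h2, -⟩ | h2
      · have h3 : (r 0 : ℕ) ≤ r i := hr.monotone (Fin.zero_le i)
        rw [h2] at h3
        simp at h3
        omega
      · exact h2
    choose r' c' h1 h2 h3 using this
    refine ⟨r', c' ∘ σ.symm, fun i j hij => ?_, fun i j hij => ?_, fun i => by simpa using h3 i⟩
    · have := hr hij
      rw [h1, h1] at this
      exact Nat.lt_of_add_lt_add_left this
    · have := hc hij
      have e1 := h2 (σ.symm i)
      have e2 := h2 (σ.symm j)
      simp only [Equiv.apply_symm_apply] at e1 e2
      rw [e1, e2] at this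
      exact Nat.lt_of_add_lt_add_left this

theorem matrixContains_reverse_columns {n k : ℕ} {A : Matrix (Fin n) (Fin n) Bool}
    {σ : Equiv.Perm (Fin k)} (h : MatrixContains A (permZeroOneMatrix σ)) :
    MatrixContains (Matrix.of fun i j => A i (Fin.rev j))
      (permZeroOneMatrix (σ.trans Fin.revPerm)) := by
  rw [matrixContains_perm_iff] at h ⊢
  obtain ⟨r, c, hr, hc, h⟩ := h
  refine ⟨r, fun j => (c j.rev).rev, hr, fun i j hij => ?_, fun i => by simpa using h i⟩
  exact Fin.rev_lt_rev.2 (hc (Fin.rev_lt_rev.2 hij))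

theorem numOnes_reverse_columns {n : ℕ} (A : Matrix (Fin n) (Fin n) Bool) :
    numOnes (Matrix.of fun i j => A i (Fin.rev j)) = numOnes A := by
  simp only [numOnes_eq_sum]
  exact Finset.sum_congr rfl fun i _ =>
    Equiv.sum_comp Fin.revPerm (fun j => if A i j = true then 1 else 0)

theorem exNumber_reverse_columns {k : ℕ} (n : ℕ) (σ : Equiv.Perm (Fin k)) :
    exNumber n (σ.trans Fin.revPerm) = exNumber n σ := by
  have key : ∀ τ : Equiv.Perm (Fin k), exNumber n τ ≤ exNumber n (τ.trans Fin.revPerm) := by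
    intro τ
    refine exNumber_le fun A hA => ?_
    rw [← numOnes_reverse_columns]
    refine numOnes_le_exNumber fun h => hA ?_
    have := matrixContains_reverse_columns h
    have e : (τ.trans Fin.revPerm).trans Fin.revPerm = τ := by ext; simp
    rw [e] at this
    convert this using 1
    ext i j
    simp
  refine le_antisymm ?_ (key σ)
  have e : (σ.trans Fin.revPerm).trans Fin.revPerm = σ := by ext; simp
  simpa [e] using key (σ.trans Fin.revPerm)

/-- Diagonal sums of extremal matrices work when `σ` ends below its start; otherwise the columns are
reversed first. For `2 ≤ k` the two end values differ. -/
theorem exNumber_add_le {k : ℕ} (hk : 2 ≤ k) (σ : Equiv.Perm (Fin k)) (a b : ℕ) :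
    exNumber a σ + exNumber b σ ≤ exNumber (a + b) σ := by
  obtain ⟨k, rfl⟩ : ∃ l, k = l + 1 := ⟨k - 1, by omega⟩
  have key : ∀ τ : Equiv.Perm (Fin (k + 1)), τ (Fin.last k) < τ 0 →
      exNumber a τ + exNumber b τ ≤ exNumber (a + b) τ := by
    intro τ hτ
    obtain ⟨A, hA, hA'⟩ := exists_numOnes_eq_exNumber (Nat.succ_pos k) a τ
    obtain ⟨B, hB, hB'⟩ := exists_numOnes_eq_exNumber (Nat.succ_pos k) b τ
    rw [← hA', ← hB', ← numOnes_boolDirectSum]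
    exact numOnes_le_exNumber (not_matrixContains_boolDirectSum hτ hA hB)
  have hne : σ (Fin.last k) ≠ σ 0 := fun h => by
    have := congrArg Fin.val (σ.injective h)
    simp at this
    omega
  rcases lt_or_gt_of_ne hne with h | h
  · exact key σ h
  · have := key (σ.trans Fin.revPerm) (Fin.rev_lt_rev.2 h)
    simpa only [exNumber_reverse_columns] using this

theorem matrixContains_of_transpose {n k : ℕ} {A : Matrix (Fin n) (Fin n) Bool}
    {σ : Equiv.Perm (Fin k)} (h : MatrixContains A.transpose (permZeroOneMatrix σ⁻¹)) :
    MatrixContains A (permZeroOneMatrix σ) := by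
  rw [matrixContains_perm_iff] at *
  obtain ⟨r, c, hr, hc, h⟩ := h
  exact ⟨c, r, hc, hr, fun i => by simpa using h (σ i)⟩

/-! ### The Marcus–Tardos block decomposition. -/

theorem finProdFinEquiv_lt_of_fst_lt {m K : ℕ} {p q : Fin m × Fin K} (h : p.1 < q.1) :
    finProdFinEquiv p < finProdFinEquiv q := by
  rw [Fin.lt_def]
  simp only [finProdFinEquiv_apply_val]
  have h1 := p.2.2
  have : K * (p.1 + 1) ≤ K * (q.1 : ℕ) := Nat.mul_le_mul_left K h
  rw [mul_add] at this
  omega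

theorem finProdFinEquiv_lt_of_snd_lt {m K : ℕ} {a : Fin m} {x y : Fin K} (h : x < y) :
    finProdFinEquiv (a, x) < finProdFinEquiv (a, y) := by
  rw [Fin.lt_def]
  simp only [finProdFinEquiv_apply_val]
  omega

/-- The ones in the `K × K` block with index `(a, b)` of `A`. -/
def blockOnes {m K : ℕ} (A : Matrix (Fin (m * K)) (Fin (m * K)) Bool) (a b : Fin m) :
    Finset (Fin K × Fin K) :=
  Finset.univ.filter fun p => A (finProdFinEquiv (a, p.1)) (finProdFinEquiv (b, p.2)) = true

theorem numOnes_eq_sum_blockOnes {m K : ℕ} (A : Matrix (Fin (m * K)) (Fin (m * K)) Bool) :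
    numOnes A = ∑ p : Fin m × Fin m, (blockOnes A p.1 p.2).card := by
  have hsum : ∀ f : Fin (m * K) → ℕ, ∑ i, f i = ∑ a, ∑ x, f (finProdFinEquiv (a, x)) := fun f => by
    rw [← Equiv.sum_comp finProdFinEquiv, Fintype.sum_prod_type]
  have : ∀ p : Fin m × Fin m, (blockOnes A p.1 p.2).card = ∑ x : Fin K, ∑ y : Fin K,
      if A (finProdFinEquiv (p.1, x)) (finProdFinEquiv (p.2, y)) = true then 1 else 0 := by
    intro p
    rw [blockOnes, Finset.card_filter, ← Finset.univ_product_univ, Finset.sum_product]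
  simp only [this, numOnes_eq_sum]
  rw [hsum, Fintype.sum_prod_type]
  refine Finset.sum_congr rfl fun a _ => ?_
  simp_rw [hsum]
  exact Finset.sum_comm

/-- In each block column, a matrix that avoids `σ` has a bounded number of blocks with ones in at
least `s` different columns. -/
theorem card_wide_le {m K s : ℕ} {σ : Equiv.Perm (Fin s)}
    {A : Matrix (Fin (m * K)) (Fin (m * K)) Bool}
    (hA : ¬ MatrixContains A (permZeroOneMatrix σ)) (b : Fin m) :
    (Finset.univ.filter fun a => s ≤ ((blockOnes A a b).image Prod.snd).card).card ≤
      2 ^ K * (s - 1) := by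
  by_contra hlt
  push Not at hlt
  have hcard : (Finset.univ : Finset (Finset (Fin K))).card = 2 ^ K := by simp
  rw [← hcard] at hlt
  -- Pigeonhole: `s` of the wide blocks occupy the same column set `C`, with at least `s` elements.
  -- The `i`-th of these blocks then provides a one in column number `σ i` of `C`.
  obtain ⟨C, -, hC⟩ := Finset.exists_lt_card_fiber_of_mul_lt_card_of_maps_to
    (f := fun a => (blockOnes A a b).image Prod.snd) (fun _ _ => Finset.mem_univ _) hlt
  set T := {x ∈ Finset.univ.filter fun a => s ≤ ((blockOnes A a b).image Prod.snd).card |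
    (blockOnes A x b).image Prod.snd = C} with hT
  have hTs : s ≤ T.card := by omega
  have hmem : ∀ a ∈ T, (blockOnes A a b).image Prod.snd = C := fun a ha => by
    rw [hT, Finset.mem_filter] at ha; exact ha.2
  rcases Nat.eq_zero_or_pos s with rfl | hs
  · exact hA ((matrixContains_perm_iff _ _).2
      ⟨Fin.elim0, Fin.elim0, fun i => i.elim0, fun i => i.elim0, fun i => i.elim0⟩)
  have hCs : s ≤ C.card := by
    obtain ⟨a, ha⟩ : T.Nonempty := Finset.card_pos.1 (by omega)
    rw [← hmem a ha]
    rw [hT, Finset.mem_filter, Finset.mem_filter] at ha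
    exact ha.1.2
  apply hA
  rw [matrixContains_perm_iff]
  have : ∀ i : Fin s, ∃ x : Fin K, A (finProdFinEquiv (T.orderEmbOfCardLe hTs i, x))
      (finProdFinEquiv (b, C.orderEmbOfCardLe hCs (σ i))) = true := by
    intro i
    have h1 := C.orderEmbOfCardLe_mem hCs (σ i)
    replace h1 := (Finset.ext_iff.1 (hmem _ (T.orderEmbOfCardLe_mem hTs i)) _).2 h1
    rw [Finset.mem_image] at h1
    obtain ⟨⟨x, y⟩, h2, h3⟩ := h1
    refine ⟨x, ?_⟩
    rw [← h3]
    simpa [blockOnes] using h2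
  choose x hx using this
  exact ⟨_, _, fun i j hij =>
      finProdFinEquiv_lt_of_fst_lt ((T.orderEmbOfCardLe hTs).strictMono hij),
    fun i j hij => finProdFinEquiv_lt_of_snd_lt ((C.orderEmbOfCardLe hCs).strictMono hij), hx⟩

theorem card_tall_le {m K s : ℕ} {σ : Equiv.Perm (Fin s)}
    {A : Matrix (Fin (m * K)) (Fin (m * K)) Bool}
    (hA : ¬ MatrixContains A (permZeroOneMatrix σ)) (a : Fin m) :
    (Finset.univ.filter fun b => s ≤ ((blockOnes A a b).image Prod.fst).card).card ≤
      2 ^ K * (s - 1) := by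
  have h := card_wide_le (σ := σ⁻¹) (A := A.transpose)
    (fun h => hA (matrixContains_of_transpose h)) a
  convert h using 5 with b
  ext x
  rw [Finset.mem_image, Finset.mem_image]
  exact ⟨fun ⟨p, hp, e⟩ => ⟨p.swap, Finset.mem_filter.2 ⟨Finset.mem_univ _,
      (Finset.mem_filter.1 hp).2⟩, e⟩, fun ⟨p, hp, e⟩ => ⟨p.swap, Finset.mem_filter.2
      ⟨Finset.mem_univ _, (Finset.mem_filter.1 hp).2⟩, e⟩⟩

/-- Contract each block to one entry. A copy of `σ` in the contraction lifts to `A`, since its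
entries come from distinct block rows and block columns. -/
theorem card_nonempty_blocks_le {m K s : ℕ} {σ : Equiv.Perm (Fin s)}
    {A : Matrix (Fin (m * K)) (Fin (m * K)) Bool}
    (hA : ¬ MatrixContains A (permZeroOneMatrix σ)) :
    (Finset.univ.filter fun p : Fin m × Fin m => (blockOnes A p.1 p.2).Nonempty).card ≤
      exNumber m σ := by
  classical
  have := numOnes_le_exNumber (σ := σ)
    (A := Matrix.of fun a b => decide (blockOnes A a b).Nonempty) ?_
  · simpa [numOnes] using this
  · intro h
    apply hA
    rw [matrixContains_perm_iff] at h ⊢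
    obtain ⟨r, c, hr, hc, h⟩ := h
    have : ∀ i, ∃ p : Fin K × Fin K,
        A (finProdFinEquiv (r i, p.1)) (finProdFinEquiv (c (σ i), p.2)) = true := by
      intro i
      obtain ⟨p, hp⟩ := of_decide_eq_true (h i)
      exact ⟨p, by simpa [blockOnes] using hp⟩
    choose p hp using this
    refine ⟨fun i => finProdFinEquiv (r i, (p i).1),
      fun j => finProdFinEquiv (c j, (p (σ.symm j)).2),
      fun i j hij => finProdFinEquiv_lt_of_fst_lt (hr hij),
      fun i j hij => finProdFinEquiv_lt_of_fst_lt (hc hij), fun i => by simpa using hp i⟩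

/-- A nonempty block that is neither wide nor tall has at most `(s - 1)^2` ones; a wide or tall
block has at most `K * K`, and there are few of those. -/
theorem exNumber_mul_le {s : ℕ} (σ : Equiv.Perm (Fin s)) (m K : ℕ) :
    exNumber (m * K) σ ≤
      (s - 1) ^ 2 * exNumber m σ + 2 * (K * K) * (m * (2 ^ K * (s - 1))) := by
  classical
  refine exNumber_le fun A hA => ?_
  rw [numOnes_eq_sum_blockOnes]
  have hle : ∀ p : Fin m × Fin m, (blockOnes A p.1 p.2).card ≤
      (s - 1) ^ 2 * (if (blockOnes A p.1 p.2).Nonempty then 1 else 0) +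
      K * K * (if s ≤ ((blockOnes A p.1 p.2).image Prod.snd).card then 1 else 0) +
      K * K * (if s ≤ ((blockOnes A p.1 p.2).image Prod.fst).card then 1 else 0) := by
    intro p
    have hK : (blockOnes A p.1 p.2).card ≤ K * K := by
      refine (Finset.card_le_univ _).trans ?_
      simp
    split_ifs with h1 h2 h3 h3 h2 h3 h3 <;> try omega
    · have hsub : blockOnes A p.1 p.2 ⊆ (blockOnes A p.1 p.2).image Prod.fst ×ˢ
          (blockOnes A p.1 p.2).image Prod.snd := Finset.subset_product
      have := Finset.card_le_card hsub
      rw [Finset.card_product] at this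
      have h4 := Nat.mul_le_mul (show ((blockOnes A p.1 p.2).image Prod.fst).card ≤ s - 1 by omega)
        (show ((blockOnes A p.1 p.2).image Prod.snd).card ≤ s - 1 by omega)
      rw [sq]
      omega
    · rw [Finset.not_nonempty_iff_eq_empty] at h1
      simp [h1]
  refine (Finset.sum_le_sum fun p _ => hle p).trans ?_
  rw [Finset.sum_add_distrib, Finset.sum_add_distrib, ← Finset.mul_sum, ← Finset.mul_sum,
    ← Finset.mul_sum]
  have h1 := card_nonempty_blocks_le hA
  rw [Finset.card_filter] at h1
  have h2 : (∑ p : Fin m × Fin m, if s ≤ ((blockOnes A p.1 p.2).image Prod.snd).card then 1 else 0)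
      ≤ m * (2 ^ K * (s - 1)) := by
    rw [← Finset.univ_product_univ, Finset.sum_product_right]
    refine (Finset.sum_le_card_nsmul _ _ (2 ^ K * (s - 1)) fun b _ => ?_).trans (by simp)
    have := card_wide_le hA b
    rwa [Finset.card_filter] at this
  have h3 : (∑ p : Fin m × Fin m, if s ≤ ((blockOnes A p.1 p.2).image Prod.fst).card then 1 else 0)
      ≤ m * (2 ^ K * (s - 1)) := by
    rw [← Finset.univ_product_univ, Finset.sum_product]
    refine (Finset.sum_le_card_nsmul _ _ (2 ^ K * (s - 1)) fun b _ => ?_).trans (by simp)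
    have := card_tall_le hA b
    rwa [Finset.card_filter] at this
  have := Nat.mul_le_mul_left ((s - 1) ^ 2) h1
  have := Nat.mul_le_mul_left (K * K) h2
  have := Nat.mul_le_mul_left (K * K) h3
  linarith

theorem mul_exNumber_le {k : ℕ} (hk : 2 ≤ k) (σ : Equiv.Perm (Fin k)) (m q : ℕ) :
    q * exNumber m σ ≤ exNumber (m * q) σ := by
  induction q with
  | zero => simp
  | succ q ih =>
    have := exNumber_add_le hk σ (m * q) m
    rw [mul_add, mul_one]
    linarith

/-- The Marcus–Tardos theorem. -/
theorem exists_exNumber_le {k : ℕ} (hk : 2 ≤ k) (σ : Equiv.Perm (Fin k)) :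
    ∃ C : ℕ, ∀ n, exNumber n σ ≤ C * n := by
  -- No iteration is needed: with `K = k^2`, superadditivity gives `k^2 ex(n) ≤ ex(n k^2) ≤ (k-1)^2
  -- ex(n) + C n`, and `(k-1)^2 + 1 ≤ k^2` leaves `ex(n) ≤ C n`.
  refine ⟨2 * (k ^ 2 * k ^ 2) * (2 ^ k ^ 2 * (k - 1)), fun n => ?_⟩
  have h1 := exNumber_mul_le σ n (k ^ 2)
  have h2 := mul_exNumber_le hk σ n (k ^ 2)
  have h3 : (k - 1) ^ 2 + 1 ≤ k ^ 2 := by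
    obtain ⟨l, rfl⟩ : ∃ l, k = l + 1 := ⟨k - 1, by omega⟩
    simp
    nlinarith
  have h4 := Nat.mul_le_mul_right (exNumber n σ) h3
  nlinarith

/-! ### The Füredi–Hajnal constant by Fekete's lemma. -/

theorem exNumber_subadditive {k : ℕ} (hk : 2 ≤ k) (σ : Equiv.Perm (Fin k)) :
    Subadditive fun n => -(exNumber n σ : ℝ) := by
  intro m n
  have : (exNumber m σ : ℝ) + exNumber n σ ≤ exNumber (m + n) σ := by
    exact_mod_cast exNumber_add_le hk σ m n
  linarith

theorem exNumber_bddBelow {k : ℕ} (hk : 2 ≤ k) (σ : Equiv.Perm (Fin k)) :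
    BddBelow (Set.range fun n : ℕ => -(exNumber n σ : ℝ) / n) := by
  obtain ⟨C, hC⟩ := exists_exNumber_le hk σ
  refine ⟨-C, ?_⟩
  rintro _ ⟨n, rfl⟩
  rcases Nat.eq_zero_or_pos n with rfl | hn
  · simp
  · have h0 : (0 : ℝ) < n := by exact_mod_cast hn
    have : (exNumber n σ : ℝ) ≤ C * n := by exact_mod_cast hC n
    simp only
    rw [le_div_iff₀ h0]
    linarith

theorem tendsto_exNumber_div {k : ℕ} (hk : 2 ≤ k) (σ : Equiv.Perm (Fin k)) :
    Tendsto (fun n : ℕ => (exNumber n σ : ℝ) / n) atTop (𝓝 (furediHajnal σ)) := by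
  have h := ((exNumber_subadditive hk σ).tendsto_lim (exNumber_bddBelow hk σ)).neg
  refine tendsto_nhds_limUnder ⟨_, h.congr fun n => ?_⟩
  rw [neg_div, neg_neg]

/-- The Fekete limit of the negated sequence is an infimum, which bounds every single term. -/
theorem exNumber_le_furediHajnal_mul {k : ℕ} (hk : 2 ≤ k) (σ : Equiv.Perm (Fin k)) {n : ℕ}
    (hn : 0 < n) : (exNumber n σ : ℝ) ≤ furediHajnal σ * n := by
  have h := (exNumber_subadditive hk σ).tendsto_lim (exNumber_bddBelow hk σ)
  have h' := (tendsto_exNumber_div hk σ).neg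
  have e : (exNumber_subadditive hk σ).lim = -furediHajnal σ := by
    refine tendsto_nhds_unique h (h'.congr fun n => ?_)
    rw [neg_div]
  have := (exNumber_subadditive hk σ).lim_le_div (exNumber_bddBelow hk σ) hn.ne'
  have h0 : (0 : ℝ) < n := by exact_mod_cast hn
  rw [e, le_div_iff₀ h0] at this
  linarith

/-- The matrix with ones exactly in its first `k - 1` rows has too few nonzero rows to contain `σ`.
-/
theorem le_exNumber {k n : ℕ} (σ : Equiv.Perm (Fin k)) (hk : 0 < k) (hn : k - 1 ≤ n) :
    (k - 1) * n ≤ exNumber n σ := by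
  have h : ¬ MatrixContains (Matrix.of fun (i _ : Fin n) => decide ((i : ℕ) < k - 1))
      (permZeroOneMatrix σ) := by
    rw [matrixContains_perm_iff]
    rintro ⟨r, c, hr, -, h⟩
    have h' : ∀ i, (r i : ℕ) < k - 1 := fun i => by simpa using h i
    have := Fintype.card_le_of_injective (fun i => (⟨r i, h' i⟩ : Fin (k - 1)))
      fun i j hij => hr.injective (Fin.ext (by simpa using hij))
    simp at this
    omega
  refine le_trans (le_of_eq ?_) (numOnes_le_exNumber h)
  have : (∑ i : Fin n, if (i : ℕ) < k - 1 then n else 0) = (k - 1) * n := by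
    rw [Fin.sum_univ_eq_sum_range (fun i => if i < k - 1 then n else 0), ← Finset.sum_filter]
    have : (Finset.range n).filter (fun i => i < k - 1) = Finset.range (k - 1) := by
      ext i; simp; omega
    rw [this]; simp
  rw [numOnes_eq_sum, ← this]
  refine Finset.sum_congr rfl fun i _ => ?_
  by_cases hi : (i : ℕ) < k - 1 <;> simp [hi]

theorem sub_one_le_furediHajnal {k : ℕ} (hk : 2 ≤ k) (σ : Equiv.Perm (Fin k)) :
    (k : ℝ) - 1 ≤ furediHajnal σ := by
  refine ge_of_tendsto (tendsto_exNumber_div hk σ) ?_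
  filter_upwards [eventually_ge_atTop k] with n hn
  have h0 : (0 : ℝ) < n := by exact_mod_cast (by omega : 0 < n)
  rw [le_div_iff₀ h0]
  have := le_exNumber (n := n) σ (by omega) (by omega)
  have h2 : (((k - 1) * n : ℕ) : ℝ) ≤ exNumber n σ := by exact_mod_cast this
  rw [Nat.cast_mul, Nat.cast_sub (by omega)] at h2
  simpa using h2

/-! ### Random sets that hit few cells. -/

section Coupon

variable {X κ : Type*} [Fintype X] [DecidableEq κ]

/-- The elements whose cell contains no element of `S`. -/
def uncovered (cell : X → κ) (S : Finset X) : Finset X :=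
  Finset.univ.filter fun x => cell x ∉ S.image cell

/-- The weight used to bound the number of sets that hit few cells but leave much uncovered. -/
noncomputable def couponWeight (cell : X → κ) (u : ℝ) (S : Finset X) : ℝ :=
  if u < (uncovered cell S).card then (1 / 2 : ℝ) ^ (S.image cell).card else 0

theorem couponWeight_nonneg (cell : X → κ) (u : ℝ) (S : Finset X) :
    0 ≤ couponWeight cell u S := by
  unfold couponWeight
  split_ifs <;> positivity

variable [DecidableEq X]

/-- Double counting of a set with a marked element; it replaces drawing the sample one point at a
time. -/
theorem succ_mul_sum_powersetCard (M : ℕ) (g : Finset X → ℝ) :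
    (M + 1 : ℝ) * ∑ T ∈ Finset.powersetCard (M + 1) Finset.univ, g T =
      ∑ S ∈ Finset.powersetCard M (Finset.univ : Finset X), ∑ x ∈ Sᶜ, g (insert x S) := by
  have h : (M + 1 : ℝ) * ∑ T ∈ Finset.powersetCard (M + 1) (Finset.univ : Finset X), g T =
      ∑ T ∈ Finset.powersetCard (M + 1) (Finset.univ : Finset X), ∑ x ∈ T, g T := by
    rw [Finset.mul_sum]
    refine Finset.sum_congr rfl fun T hT => ?_
    rw [Finset.sum_const, (Finset.mem_powersetCard.1 hT).2]
    simp
  rw [h, Finset.sum_sigma', Finset.sum_sigma']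
  refine Finset.sum_bij' (fun p _ => ⟨p.1.erase p.2, p.2⟩) (fun p _ => ⟨insert p.2 p.1, p.2⟩)
    ?_ ?_ ?_ ?_ ?_
  · rintro ⟨T, x⟩ h
    simp only [Finset.mem_sigma, Finset.mem_powersetCard, Finset.subset_univ, true_and] at h ⊢
    simp [Finset.card_erase_of_mem h.2, h.1]
  · rintro ⟨S, x⟩ h
    simp only [Finset.mem_sigma, Finset.mem_powersetCard, Finset.subset_univ, true_and,
      Finset.mem_compl] at h ⊢
    simp [Finset.card_insert_of_notMem h.2, h.1]
  · rintro ⟨T, x⟩ h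
    simp only [Finset.mem_sigma] at h
    simp [Finset.insert_erase h.2]
  · rintro ⟨S, x⟩ h
    simp only [Finset.mem_sigma, Finset.mem_compl] at h
    simp [Finset.erase_insert h.2]
  · rintro ⟨T, x⟩ h
    simp only [Finset.mem_sigma] at h
    simp [Finset.insert_erase h.2]

theorem uncovered_subset_compl (cell : X → κ) (S : Finset X) : uncovered cell S ⊆ Sᶜ := by
  intro x hx
  simp only [uncovered, Finset.mem_filter, Finset.mem_univ, true_and] at hx
  exact Finset.mem_compl.2 fun h => hx (Finset.mem_image_of_mem _ h)

theorem uncovered_insert_subset (cell : X → κ) (S : Finset X) (x : X) :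
    uncovered cell (insert x S) ⊆ uncovered cell S := by
  intro y hy
  simp only [uncovered, Finset.mem_filter, Finset.mem_univ, true_and, Finset.image_insert,
    Finset.mem_insert, not_or] at hy ⊢
  exact hy.2

/-- Supermartingale step: above the threshold, a random new point falls into an unhit cell with
probability at least `δ`, which at least halves the weight. Once the weight is zero it stays zero,
because the uncovered set only shrinks. -/
theorem sum_couponWeight_insert_le (cell : X → κ) {δ : ℝ} (hδ : 0 ≤ δ) (S : Finset X) :
    ∑ x ∈ Sᶜ, couponWeight cell (δ * Fintype.card X) (insert x S) ≤
      couponWeight cell (δ * Fintype.card X) S * ((Sᶜ.card : ℝ) * (1 - δ / 2)) := by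
  by_cases hu : δ * Fintype.card X < (uncovered cell S).card
  · have hw : couponWeight cell (δ * Fintype.card X) S = (1 / 2 : ℝ) ^ (S.image cell).card :=
      if_pos hu
    set w : ℝ := (1 / 2 : ℝ) ^ (S.image cell).card with hw'
    have hw0 : 0 ≤ w := by positivity
    have hle : ∀ x ∈ Sᶜ, couponWeight cell (δ * Fintype.card X) (insert x S) ≤
        w - if x ∈ uncovered cell S then w / 2 else 0 := by
      intro x hx
      split_ifs with hxu
      · simp only [uncovered, Finset.mem_filter, Finset.mem_univ, true_and] at hxu
        unfold couponWeight
        split_ifs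
        · rw [Finset.image_insert, Finset.card_insert_of_notMem hxu, pow_succ, ← hw']
          linarith
        · linarith
      · simp only [uncovered, Finset.mem_filter, Finset.mem_univ, true_and, not_not] at hxu
        unfold couponWeight
        split_ifs
        · rw [Finset.image_insert, Finset.insert_eq_of_mem hxu, ← hw']
          linarith
        · linarith
    refine (Finset.sum_le_sum hle).trans ?_
    rw [Finset.sum_sub_distrib, Finset.sum_const, ← Finset.sum_filter,
      Finset.filter_mem_eq_inter, Finset.inter_eq_right.2 (uncovered_subset_compl cell S),
      Finset.sum_const, hw, nsmul_eq_mul, nsmul_eq_mul]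
    -- Uncovered points all lie outside `S`, so their share of `Sᶜ` is no smaller than their share
    -- of `X`.
    have h1 : (Sᶜ.card : ℝ) ≤ Fintype.card X := by exact_mod_cast Finset.card_le_univ _
    have h2 : δ * Sᶜ.card ≤ (uncovered cell S).card := (mul_le_mul_of_nonneg_left h1 hδ).trans hu.le
    nlinarith
  · have hw : couponWeight cell (δ * Fintype.card X) S = 0 := if_neg hu
    rw [hw, zero_mul]
    refine (Finset.sum_eq_zero fun x _ => if_neg fun h => hu (h.trans_le ?_)).le
    exact_mod_cast Finset.card_le_card (uncovered_insert_subset cell S x)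

theorem sum_couponWeight_le (cell : X → κ) {δ : ℝ} (hδ : 0 ≤ δ) (hδ1 : δ ≤ 1) (M : ℕ) :
    ∑ S ∈ Finset.powersetCard M Finset.univ, couponWeight cell (δ * Fintype.card X) S ≤
      (Fintype.card X).choose M * (1 - δ / 2) ^ M := by
  induction M with
  | zero =>
    simp only [Finset.powersetCard_zero, Finset.sum_singleton, couponWeight]
    split_ifs <;> simp
  | succ M ih =>
    rcases Nat.lt_or_ge (Fintype.card X) (M + 1) with hlt | hge
    · rw [Finset.powersetCard_eq_empty.2 (by simpa using hlt)]
      simp only [Finset.sum_empty]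
      have : 0 ≤ 1 - δ / 2 := by linarith
      positivity
    · have hM : (0 : ℝ) < (M : ℝ) + 1 := by positivity
      refine le_of_mul_le_mul_left ?_ hM
      rw [succ_mul_sum_powersetCard]
      have hch : ((M : ℝ) + 1) * (Fintype.card X).choose (M + 1) =
          (Fintype.card X).choose M * ((Fintype.card X : ℝ) - M) := by
        have := Nat.choose_succ_right_eq (Fintype.card X) M
        rw [mul_comm, ← Nat.cast_sub (by omega : M ≤ Fintype.card X)]
        exact_mod_cast this
      have hstep : ∀ S ∈ Finset.powersetCard M (Finset.univ : Finset X),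
          ∑ x ∈ Sᶜ, couponWeight cell (δ * Fintype.card X) (insert x S) ≤
            couponWeight cell (δ * Fintype.card X) S *
              (((Fintype.card X : ℝ) - M) * (1 - δ / 2)) := by
        intro S hS
        have hc := (Finset.mem_powersetCard.1 hS).2
        refine (sum_couponWeight_insert_le cell hδ S).trans (le_of_eq ?_)
        rw [Finset.card_compl, hc, Nat.cast_sub (by omega)]
      refine (Finset.sum_le_sum hstep).trans ?_
      rw [← Finset.sum_mul]
      have hn : (M : ℝ) ≤ Fintype.card X := by exact_mod_cast (by omega : M ≤ Fintype.card X)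
      have h0 : 0 ≤ ((Fintype.card X : ℝ) - M) * (1 - δ / 2) :=
        mul_nonneg (by linarith) (by linarith)
      refine (mul_le_mul_of_nonneg_right ih h0).trans (le_of_eq ?_)
      rw [← mul_assoc ((M : ℝ) + 1), hch]
      ring

/-- Few `M`-sets hit at most `m` cells while more than a `δ`-fraction lies in cells not hit. -/
theorem card_uncovered_gt_le (cell : X → κ) {δ : ℝ} (hδ : 0 ≤ δ) (hδ1 : δ ≤ 1) (M m : ℕ) :
    (((Finset.powersetCard M Finset.univ).filter fun S : Finset X =>
      (S.image cell).card ≤ m ∧ δ * Fintype.card X < (uncovered cell S).card).card : ℝ) ≤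
      (Fintype.card X).choose M * Real.exp (m - δ * M / 2) := by
  -- Markov's inequality: each counted set has weight at least `(1/2)^m`.
  have h1 : (((Finset.powersetCard M Finset.univ).filter fun S : Finset X =>
      (S.image cell).card ≤ m ∧ δ * Fintype.card X < (uncovered cell S).card).card : ℝ) *
      (1 / 2 : ℝ) ^ m ≤ (Fintype.card X).choose M * (1 - δ / 2) ^ M := by
    refine le_trans ?_ (sum_couponWeight_le cell hδ hδ1 M)
    rw [← nsmul_eq_mul]
    refine (Finset.card_nsmul_le_sum _ (couponWeight cell (δ * Fintype.card X)) _ ?_).trans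
      (Finset.sum_le_sum_of_subset_of_nonneg (Finset.filter_subset _ _)
        fun S _ _ => couponWeight_nonneg cell _ S)
    intro S hS
    obtain ⟨-, h2, h3⟩ := Finset.mem_filter.1 hS
    rw [couponWeight, if_pos h3]
    exact pow_le_pow_of_le_one (by norm_num) (by norm_num) h2
  have h2 : (1 - δ / 2) ^ M ≤ Real.exp (-(δ * M / 2)) := by
    have : 1 - δ / 2 ≤ Real.exp (-(δ / 2)) := by
      have := Real.add_one_le_exp (-(δ / 2))
      linarith
    refine (pow_le_pow_left₀ (by linarith) this M).trans (le_of_eq ?_)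
    rw [← Real.exp_nat_mul]
    ring_nf
  have h3 : (2 : ℝ) ^ m ≤ Real.exp m := by
    have : (2 : ℝ) ≤ Real.exp 1 := by
      have := Real.add_one_le_exp (1 : ℝ)
      linarith
    refine (pow_le_pow_left₀ (by norm_num) this m).trans (le_of_eq ?_)
    rw [← Real.exp_nat_mul, mul_one]
  rw [one_div, inv_pow, ← div_eq_mul_inv, div_le_iff₀ (by positivity)] at h1
  refine h1.trans ?_
  rw [show (m : ℝ) - δ * M / 2 = -(δ * M / 2) + m by ring, Real.exp_add, mul_assoc]
  gcongr

end Coupon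

/-! ### Total displacement of order-preserving matchings. -/

/-- The distance of two natural numbers counts the thresholds that separate them. -/
theorem abs_sub_eq_sum_thresholds {N a b : ℕ} (ha : a ≤ N) (hb : b ≤ N) :
    |(a : ℝ) - b| = ∑ t ∈ Finset.range N, |(if t < a then (1 : ℝ) else 0) - if t < b then 1 else 0| := by
  have key : ∀ a b : ℕ, a ≤ b → b ≤ N → |(a : ℝ) - b| =
      ∑ t ∈ Finset.range N, |(if t < a then (1 : ℝ) else 0) - if t < b then 1 else 0| := by
    intro a b hab hb
    have : ∀ t, |(if t < a then (1 : ℝ) else 0) - if t < b then 1 else 0| =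
        (if t < b then (1 : ℝ) else 0) - if t < a then 1 else 0 := by
      intro t
      split_ifs <;> first | omega | simp
    have hr : ∀ c ≤ N, ∑ t ∈ Finset.range N, (if t < c then (1 : ℝ) else 0) = c := by
      intro c hc
      rw [← Finset.sum_filter]
      have : (Finset.range N).filter (fun i => i < c) = Finset.range c := by
        ext i; simp; omega
      rw [this]; simp
    simp only [this, Finset.sum_sub_distrib, hr b hb, hr a (hab.trans hb)]
    have : (a : ℝ) ≤ b := by exact_mod_cast hab
    rw [abs_sub_comm, abs_of_nonneg (by linarith)]
  rcases le_total a b with h | h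
  · exact key a b h hb
  · rw [abs_sub_comm, key b a h ha]
    exact Finset.sum_congr rfl fun t _ => abs_sub_comm _ _

/-- Among the bijective assignments of targets to points `p`, an order-preserving one has least
total displacement. -/
theorem sum_abs_sub_le_of_monotone {n : ℕ} (p : Fin n → Fin n) (θ τ : Equiv.Perm (Fin n))
    (h : ∀ i j, p i < p j → θ i < θ j) :
    ∑ i, |((p i : ℕ) : ℝ) - ((θ i : ℕ) : ℝ)| ≤ ∑ i, |((p i : ℕ) : ℝ) - ((τ i : ℕ) : ℝ)| := by
  have e : ∀ τ : Equiv.Perm (Fin n), ∑ i, |((p i : ℕ) : ℝ) - ((τ i : ℕ) : ℝ)| =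
      ∑ t ∈ Finset.range n, ∑ i, |(if t < (p i : ℕ) then (1 : ℝ) else 0) -
        if t < (τ i : ℕ) then 1 else 0| := by
    intro τ
    rw [Finset.sum_comm]
    exact Finset.sum_congr rfl fun i _ => abs_sub_eq_sum_thresholds (p i).2.le (τ i).2.le
  rw [e, e]
  refine Finset.sum_le_sum fun t _ => ?_
  -- At each threshold the signed sum depends only on the number of targets above it, so it is the
  -- same for `θ` and `τ`. For order-preserving `θ` all its terms have one sign, so there is no
  -- cancellation.
  have hcard : ∑ i, (if t < (θ i : ℕ) then (1 : ℝ) else 0) =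
      ∑ i, if t < (τ i : ℕ) then (1 : ℝ) else 0 := by
    rw [Equiv.sum_comp θ (fun i : Fin n => if t < (i : ℕ) then (1 : ℝ) else 0),
      Equiv.sum_comp τ (fun i : Fin n => if t < (i : ℕ) then (1 : ℝ) else 0)]
  have habs : |∑ i, ((if t < (p i : ℕ) then (1 : ℝ) else 0) - if t < (τ i : ℕ) then 1 else 0)| ≤
      ∑ i, |(if t < (p i : ℕ) then (1 : ℝ) else 0) - if t < (τ i : ℕ) then 1 else 0| :=
    Finset.abs_sum_le_sum_abs _ _
  refine le_trans (le_of_eq ?_) habs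
  rw [Finset.sum_sub_distrib, ← hcard, ← Finset.sum_sub_distrib]
  by_cases hc : ∃ i, t < (p i : ℕ) ∧ ¬ t < (θ i : ℕ)
  · obtain ⟨i, hi1, hi2⟩ := hc
    have hall : ∀ j, (0 : ℝ) ≤ (if t < (p j : ℕ) then (1 : ℝ) else 0) -
        if t < (θ j : ℕ) then 1 else 0 := by
      intro j
      split_ifs with h1 h2 h2 <;> try simp
      have h3 : (θ j : ℕ) < θ i := h j i (by rw [Fin.lt_def]; omega)
      omega
    rw [abs_of_nonneg (Finset.sum_nonneg fun j _ => hall j)]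
    exact Finset.sum_congr rfl fun j _ => abs_of_nonneg (hall j)
  · push Not at hc
    have hall : ∀ j, (if t < (p j : ℕ) then (1 : ℝ) else 0) -
        (if t < (θ j : ℕ) then 1 else 0) ≤ 0 := by
      intro j
      split_ifs with h1 h2 h2 <;> try simp
      have := hc j h1
      omega
    rw [abs_of_nonpos (Finset.sum_nonpos fun j _ => hall j), ← Finset.sum_neg_distrib]
    exact Finset.sum_congr rfl fun j _ => abs_of_nonpos (hall j)

/-- Triangle inequality through `p`; `τ` competes with the optimal `θ`, hence the factor two. -/
theorem sum_abs_sub_le_two_mul {n : ℕ} (p : Fin n → Fin n) (θ τ : Equiv.Perm (Fin n))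
    (h : ∀ i j, p i < p j → θ i < θ j) :
    ∑ i, |((τ i : ℕ) : ℝ) - ((θ i : ℕ) : ℝ)| ≤ 2 * ∑ i, |((τ i : ℕ) : ℝ) - ((p i : ℕ) : ℝ)| := by
  have h1 := sum_abs_sub_le_of_monotone p θ τ h
  have h2 : ∑ i, |((τ i : ℕ) : ℝ) - ((θ i : ℕ) : ℝ)| ≤
      ∑ i, (|((τ i : ℕ) : ℝ) - ((p i : ℕ) : ℝ)| + |((p i : ℕ) : ℝ) - ((θ i : ℕ) : ℝ)|) :=
    Finset.sum_le_sum fun i _ => abs_sub_le _ _ _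
  rw [Finset.sum_add_distrib] at h2
  have h3 : ∑ i, |((p i : ℕ) : ℝ) - ((τ i : ℕ) : ℝ)| = ∑ i, |((τ i : ℕ) : ℝ) - ((p i : ℕ) : ℝ)| :=
    Finset.sum_congr rfl fun i _ => abs_sub_comm _ _
  linarith

/-! ### Sorting by adjacent swaps: planar tau against earth mover's distance. -/

/-- The inversions of a permutation. -/
def permInversions {n : ℕ} (θ : Equiv.Perm (Fin n)) : Finset (Fin n × Fin n) :=
  Finset.univ.filter fun p => p.1 < p.2 ∧ θ p.2 < θ p.1

/-- An inversion `(i, j)` is charged to the displacement of `i` if `j ≤ θ i`, as `j` is then in `(i,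
θ i]`, and otherwise to that of `j`, as `θ i` is then in `(θ j, j]`. -/
theorem card_permInversions_le {n : ℕ} (θ : Equiv.Perm (Fin n)) :
    (permInversions θ).card ≤ ∑ i, (((θ i : ℕ) - (i : ℕ)) + ((i : ℕ) - (θ i : ℕ))) := by
  classical
  rw [Finset.sum_add_distrib]
  have hsub : permInversions θ ⊆
      (Finset.univ.sigma fun i : Fin n => Finset.Ioc i (θ i)).image (fun p => (p.1, p.2)) ∪
      (Finset.univ.sigma fun j : Fin n => Finset.Ioc (θ j) j).image
        (fun p => (θ.symm p.2, p.1)) := by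
    rintro ⟨i, j⟩ h
    simp only [permInversions, Finset.mem_filter, Finset.mem_univ, true_and] at h
    rw [Finset.mem_union]
    rcases le_or_gt j (θ i) with h1 | h1
    · left
      exact Finset.mem_image.2 ⟨⟨i, j⟩, by simp [h.1, h1], rfl⟩
    · right
      exact Finset.mem_image.2 ⟨⟨j, θ i⟩, by simp [h.2, h1.le], by simp⟩
  refine (Finset.card_le_card hsub).trans ((Finset.card_union_le _ _).trans ?_)
  refine Nat.add_le_add (Finset.card_image_le.trans ?_) (Finset.card_image_le.trans ?_) <;>
  · rw [Finset.card_sigma]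
    simp

/-- Applying the swap to both entries of a pair injects the new inversions into the old ones other
than `(i, j)`. -/
theorem card_permInversions_mul_swap_lt {n : ℕ} (θ : Equiv.Perm (Fin n)) {i j : Fin n}
    (hij : (i : ℕ) + 1 = j) (h : θ j < θ i) :
    (permInversions (θ * Equiv.swap i j)).card < (permInversions θ).card := by
  classical
  have hlt : i < j := by rw [Fin.lt_def]; omega
  have hmem : (i, j) ∈ permInversions θ := by simp [permInversions, hlt, h]
  have key : (permInversions (θ * Equiv.swap i j)).card ≤ ((permInversions θ).erase (i, j)).card := by
    refine Finset.card_le_card_of_injOn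
      (fun p => (Equiv.swap i j p.1, Equiv.swap i j p.2)) ?_ ?_
    · rintro ⟨a, b⟩ hp
      rw [permInversions, Finset.mem_coe, Finset.mem_filter] at hp
      obtain ⟨-, h1, h2⟩ := hp
      simp only [Equiv.Perm.mul_apply] at h1 h2
      simp only [permInversions, Finset.coe_erase, Set.mem_sdiff, Finset.mem_coe, Finset.mem_filter,
        Finset.mem_univ, true_and, Set.mem_singleton_iff, Prod.mk.injEq]
      have hne : ¬ (a = i ∧ b = j) := by
        rintro ⟨rfl, rfl⟩
        simp only [Equiv.swap_apply_left, Equiv.swap_apply_right] at h2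
        exact absurd h2 (not_lt.2 h.le)
      refine ⟨⟨?_, h2⟩, ?_⟩
      · rw [Equiv.swap_apply_def, Equiv.swap_apply_def]
        simp only [Fin.ext_iff] at hne
        split_ifs <;> simp only [Fin.ext_iff, Fin.lt_def] at * <;> omega
      · rintro ⟨h3, h4⟩
        have h3' : a = j := by rw [← Equiv.swap_apply_left i j]; exact (Equiv.swap_apply_eq_iff.1 h3)
        have h4' : b = i := by rw [← Equiv.swap_apply_right i j]; exact (Equiv.swap_apply_eq_iff.1 h4)
        subst h3' h4'
        exact absurd hlt (not_lt.2 h1.le)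
    · rintro ⟨a, b⟩ - ⟨c, d⟩ - hp
      simpa using hp
  have := Finset.card_erase_lt_of_mem hmem
  omega

theorem exists_adjacent_descent {n : ℕ} {θ : Equiv.Perm (Fin n)} (h : θ ≠ 1) :
    ∃ i j : Fin n, (i : ℕ) + 1 = j ∧ θ j < θ i := by
  by_contra hc
  push Not at hc
  apply h
  rcases n with _ | n
  · exact Subsingleton.elim _ _
  have hm : StrictMono θ := by
    rw [Fin.strictMono_iff_lt_succ]
    intro i
    exact lt_of_le_of_ne (hc i.castSucc i.succ (by simp))
      fun e => (Fin.castSucc_lt_succ (i := i)).ne (θ.injective e)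
  ext i
  have := Subsingleton.elim (hm.orderIsoOfSurjective θ θ.surjective) (OrderIso.refl _)
  have := congrArg (fun e => e i) this
  simpa using congrArg Fin.val this

/-- `b` is obtained from `a` by `m` planar simple transpositions. -/
def PlanarPath {n : ℕ} (m : ℕ) (a b : Equiv.Perm (Fin n)) : Prop :=
  ∃ p : ℕ → Equiv.Perm (Fin n), p 0 = a ∧ p m = b ∧ ∀ t < m, PlanarStep (p t) (p (t + 1))

theorem PlanarPath.trans {n k m : ℕ} {a b c : Equiv.Perm (Fin n)} (h : PlanarPath k a b)
    (h' : PlanarPath m b c) : PlanarPath (k + m) a c := by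
  obtain ⟨p, hp0, hp1, hp⟩ := h
  obtain ⟨q, hq0, hq1, hq⟩ := h'
  refine ⟨fun t => if t ≤ k then p t else q (t - k), by simpa using hp0, ?_, fun t ht => ?_⟩
  · rcases Nat.eq_zero_or_pos m with rfl | hm
    · simp [hp1, ← hq1, hq0]
    · simp only
      rw [if_neg (by omega), Nat.add_sub_cancel_left, hq1]
  · simp only
    rcases lt_trichotomy t k with h1 | h1 | h1
    · rw [if_pos h1.le, if_pos (by omega)]
      exact hp t h1
    · rw [if_pos h1.le, if_neg (by omega), h1, hp1, ← hq0, Nat.add_sub_cancel_left]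
      exact hq 0 (by omega)
    · rw [if_neg (by omega), if_neg (by omega), show t + 1 - k = t - k + 1 by omega]
      exact hq _ (by omega)

theorem PlanarPath.single {n : ℕ} {a b : Equiv.Perm (Fin n)} (h : PlanarStep a b) :
    PlanarPath 1 a b :=
  ⟨fun t => if t = 0 then a else b, by simp, by simp, fun t ht => by
    obtain rfl : t = 0 := by omega
    simpa using h⟩

theorem exists_planarPath_mul_inv {n : ℕ} (θ π : Equiv.Perm (Fin n)) :
    ∃ m ≤ (permInversions θ).card, PlanarPath m π (π * θ⁻¹) := by
  induction hN : (permInversions θ).card using Nat.strong_induction_on generalizing θ π with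
  | _ N ih =>
    by_cases h : θ = 1
    · exact ⟨0, Nat.zero_le _, fun _ => π, rfl, by simp [h], fun t ht => by omega⟩
    obtain ⟨i, j, hij, hlt⟩ := exists_adjacent_descent h
    have hd := card_permInversions_mul_swap_lt θ hij hlt
    rw [hN] at hd
    obtain ⟨m, hm, hp⟩ := ih _ hd (θ * Equiv.swap i j) (π * Equiv.swap i j) rfl
    refine ⟨1 + m, by omega, (PlanarPath.single ⟨i, j, hij, Or.inl rfl⟩).trans ?_⟩
    convert hp using 1
    rw [mul_inv_rev, Equiv.swap_inv, mul_assoc, ← mul_assoc (Equiv.swap i j), Equiv.swap_mul_self,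
      one_mul]

theorem exists_planarPath_mul_left {n : ℕ} (θ π : Equiv.Perm (Fin n)) :
    ∃ m ≤ (permInversions θ).card, PlanarPath m π (θ * π) := by
  induction hN : (permInversions θ).card using Nat.strong_induction_on generalizing θ π with
  | _ N ih =>
    by_cases h : θ = 1
    · exact ⟨0, Nat.zero_le _, fun _ => π, rfl, by simp [h], fun t ht => by omega⟩
    obtain ⟨i, j, hij, hlt⟩ := exists_adjacent_descent h
    have hd := card_permInversions_mul_swap_lt θ hij hlt
    rw [hN] at hd
    obtain ⟨m, hm, hp⟩ := ih _ hd (θ * Equiv.swap i j) (Equiv.swap i j * π) rfl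
    refine ⟨1 + m, by omega, (PlanarPath.single ⟨i, j, hij, Or.inr rfl⟩).trans ?_⟩
    convert hp using 1
    rw [mul_assoc, ← mul_assoc (Equiv.swap i j), Equiv.swap_mul_self, one_mul]

theorem cast_card_permInversions_le {n : ℕ} (θ : Equiv.Perm (Fin n)) :
    ((permInversions θ).card : ℝ) ≤ ∑ i : Fin n, |(((i : Fin n) : ℕ) : ℝ) - ((θ i : ℕ) : ℝ)| := by
  have h : ((permInversions θ).card : ℝ) ≤
      ∑ i : Fin n, (((((θ i : ℕ) - (i : ℕ)) + ((i : ℕ) - (θ i : ℕ)) : ℕ)) : ℝ) := by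
    exact_mod_cast card_permInversions_le θ
  refine h.trans (Finset.sum_le_sum fun i _ => ?_)
  rcases le_total (i : ℕ) (θ i) with h1 | h1
  · rw [Nat.sub_eq_zero_of_le h1, add_zero, Nat.cast_sub h1, abs_sub_comm]
    exact le_abs_self _
  · rw [Nat.sub_eq_zero_of_le h1, zero_add, Nat.cast_sub h1]
    exact le_abs_self _

/-- Factor `π₂ = (π₂ θ π₁⁻¹)(π₁ θ⁻¹)`: bubble sort positions along `θ`, then values along `π₂ θ
π₁⁻¹`. The inversions of the two factors are bounded by the position and value parts of the cost. -/
theorem planarSteps_le {n : ℕ} (π₁ π₂ θ : Equiv.Perm (Fin n)) :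
    (planarSteps π₁ π₂ : ℝ) ≤ ∑ i : Fin n, (|((i : ℕ) : ℝ) - ((θ i : ℕ) : ℝ)| +
      |((π₁ i : ℕ) : ℝ) - ((π₂ (θ i) : ℕ) : ℝ)|) := by
  obtain ⟨m, hm, hp⟩ := exists_planarPath_mul_inv θ π₁
  obtain ⟨m', hm', hp'⟩ := exists_planarPath_mul_left (π₂ * θ * π₁⁻¹) (π₁ * θ⁻¹)
  have e : π₂ * θ * π₁⁻¹ * (π₁ * θ⁻¹) = π₂ := by group
  rw [e] at hp'
  have h1 : planarSteps π₁ π₂ ≤ m + m' := Nat.sInf_le (hp.trans hp')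
  have h2 : (planarSteps π₁ π₂ : ℝ) ≤
      (permInversions θ).card + (permInversions (π₂ * θ * π₁⁻¹)).card := by
    exact_mod_cast h1.trans (Nat.add_le_add hm hm')
  have h3 := cast_card_permInversions_le (π₂ * θ * π₁⁻¹)
  rw [← Equiv.sum_comp π₁] at h3
  have e' : ∀ i, (π₂ * θ * π₁⁻¹) (π₁ i) = π₂ (θ i) := fun i => by simp
  simp only [e'] at h3
  rw [Finset.sum_add_distrib]
  linarith [cast_card_permInversions_le θ]

theorem planarTauDist_le_earthMoverDist {n : ℕ} (π₁ π₂ : Equiv.Perm (Fin n)) :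
    planarTauDist π₁ π₂ ≤ earthMoverDist π₁ π₂ :=
  mul_le_mul_of_nonneg_left (le_ciInf fun θ => planarSteps_le π₁ π₂ θ) (by positivity)

theorem earthMoverDist_nonneg {n : ℕ} (π₁ π₂ : Equiv.Perm (Fin n)) :
    0 ≤ earthMoverDist π₁ π₂ :=
  mul_nonneg (by positivity) (le_ciInf fun θ => by positivity)

theorem planarTauDist_nonneg {n : ℕ} (π₁ π₂ : Equiv.Perm (Fin n)) :
    0 ≤ planarTauDist π₁ π₂ := by
  unfold planarTauDist
  positivity

theorem distToProperty_le {n : ℕ} {d : Equiv.Perm (Fin n) → Equiv.Perm (Fin n) → ℝ}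
    (hd : ∀ π ρ, 0 ≤ d π ρ) {P : PermProperty} {π ρ : Equiv.Perm (Fin n)} (hρ : ρ ∈ P n) :
    distToProperty d P π ≤ d π ρ := by
  rw [distToProperty, if_pos ⟨ρ, hρ⟩]
  exact ciInf_le ⟨0, by rintro _ ⟨x, rfl⟩; exact hd _ _⟩ (⟨ρ, hρ⟩ : P n)

theorem distToProperty_planarTauDist_le {n : ℕ} {P : PermProperty} {π ρ : Equiv.Perm (Fin n)}
    (hρ : ρ ∈ P n) : distToProperty planarTauDist P π ≤ earthMoverDist π ρ :=
  (distToProperty_le planarTauDist_nonneg hρ).trans (planarTauDist_le_earthMoverDist _ _)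

/-! ### From an accepted sample to a nearby member of the property. -/

theorem exists_perm_lt_iff {N : ℕ} {α : Type*} [LinearOrder α] {g : Fin N → α}
    (hg : Function.Injective g) :
    ∃ β : Equiv.Perm (Fin N), ∀ i j, β i < β j ↔ g i < g j := by
  have hc : (Finset.univ.image g).card = N := by
    rw [Finset.card_image_of_injective _ hg]; simp
  set e := (Finset.univ.image g).orderIsoOfFin hc
  let b : Fin N → Fin N := fun i => e.symm ⟨g i, Finset.mem_image_of_mem _ (Finset.mem_univ i)⟩
  have hb : ∀ i j, b i < b j ↔ g i < g j := fun i j => by simp [b]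
  have hinj : Function.Injective b := fun i j hij => by
    simpa [b, hg.eq_iff] using hij
  exact ⟨Equiv.ofBijective b (Finite.injective_iff_bijective.1 hinj), hb⟩

theorem isSubpermutation_inducedPerm {n M k : ℕ} (σ : Equiv.Perm (Fin k)) (π : Equiv.Perm (Fin n))
    (S : Finset (Fin n)) (hS : S.card = M) (x : Fin k → Fin n) (hx : StrictMono x)
    (hxS : ∀ i, x i ∈ S) (hσ : ∀ i j, σ i < σ j → π (x i) < π (x j)) :
    IsSubpermutation σ (inducedPerm π S hS) := by
  have hm : StrictMono fun i => (S.orderIsoOfFin hS).symm ⟨x i, hxS i⟩ := fun i j hij => by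
    simpa using hx hij
  refine ⟨OrderEmbedding.ofStrictMono _ hm, fun i j => ?_⟩
  rw [inducedPerm_lt_iff]
  have e : ∀ i, S.orderEmbOfFin hS ((S.orderIsoOfFin hS).symm ⟨x i, hxS i⟩) = x i := fun i => by
    rw [← Finset.coe_orderIsoOfFin_apply]; simp
  simp only [OrderEmbedding.coe_ofStrictMono, e]
  refine ⟨fun h => ?_, hσ i j⟩
  by_contra hn
  rcases (not_lt.1 hn).lt_or_eq with h1 | h1
  · exact absurd h (not_lt.2 (hσ _ _ h1).le)
  · rw [σ.injective h1] at h
    exact lt_irrefl _ h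

theorem IsKBlowUp.exists_eq_mul {m N k : ℕ} {α : Equiv.Perm (Fin m)} {β : Equiv.Perm (Fin N)}
    (h : IsKBlowUp k α β) :
    N = m * k ∧ ∀ (j₁ j₂ : Fin m) (i₁ i₂ : Fin N), j₁ ≠ j₂ →
      (j₁ : ℕ) * k ≤ i₁ → (i₁ : ℕ) < j₁ * k + k → (j₂ : ℕ) * k ≤ i₂ → (i₂ : ℕ) < j₂ * k + k →
      (β i₂ < β i₁ ↔ α j₂ < α j₁) := by
  obtain ⟨t, ⟨-, ht0, htm, hcmp⟩, ht⟩ := h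
  have hval : ∀ j : Fin (m + 1), t j = j * k := by
    intro j
    induction j using Fin.induction with
    | zero => simp [ht0]
    | succ j ih => rw [ht j, ih]; simp; ring
  refine ⟨by rw [← htm, hval]; simp, fun j₁ j₂ i₁ i₂ hne h1 h2 h3 h4 => ?_⟩
  refine hcmp j₁ j₂ i₁ i₂ hne ?_ ?_ ?_ ?_
  · rw [hval]; simpa using h1
  · rw [ht, hval]; simpa using h2
  · rw [hval]; simpa using h3
  · rw [ht, hval]; simpa using h4

theorem IsKBlowUp.isSubpermutation {m N k : ℕ} (hk : 0 < k) {α : Equiv.Perm (Fin m)}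
    {β : Equiv.Perm (Fin N)} (h : IsKBlowUp k α β) : IsSubpermutation α β := by
  obtain ⟨rfl, h⟩ := h.exists_eq_mul
  have hlt : ∀ j : Fin m, (j : ℕ) * k < m * k := fun j => Nat.mul_lt_mul_of_pos_right j.2 hk
  refine ⟨OrderEmbedding.ofStrictMono (fun j => ⟨(j : ℕ) * k, hlt j⟩)
    fun i j hij => Nat.mul_lt_mul_of_pos_right hij hk, fun i j => ?_⟩
  by_cases hij : i = j
  · subst hij; simp
  · exact h j i _ _ (Ne.symm hij) le_rfl (Nat.lt_add_of_pos_right hk) le_rfl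
      (Nat.lt_add_of_pos_right hk)

theorem TesterAccepts.mem {P : PermProperty} (hP : P.Hereditary) {M : ℕ} {α : Equiv.Perm (Fin M)}
    (h : TesterAccepts P α) : α ∈ P M := by
  obtain ⟨N, β, h1, h2⟩ := h 1 one_pos
  exact hP _ _ _ _ h2 (h1.isSubpermutation one_pos)

/-- If the sample is accepted, then moving every point to a sample point and replacing the sample
points by blocks gives an element of the property. -/
theorem exists_mem_earthMoverDist_le {P : PermProperty} (hP : P.Hereditary) {n M : ℕ} (hn : 0 < n)
    (π : Equiv.Perm (Fin n)) (S : Finset (Fin n)) (hS : S.card = M)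
    (hacc : TesterAccepts P (inducedPerm π S hS)) (y : Fin n → Fin n) (hy : ∀ i, y i ∈ S) :
    ∃ ρ ∈ P n, earthMoverDist π ρ ≤ 1 / (n.choose 2 : ℝ) *
      (2 * ∑ i : Fin n, (|((i : ℕ) : ℝ) - ((y i : ℕ) : ℝ)| +
        |((π i : ℕ) : ℝ) - ((π (y i) : ℕ) : ℝ)|)) := by
  -- Blocks of size `n` have room for all points, even if every point moves to the same sample
  -- point.
  obtain ⟨N, β, hbl, hβ⟩ := hacc n hn
  obtain ⟨rfl, hcmp⟩ := hbl.exists_eq_mul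
  have hf : ∀ i, ∃ j : Fin M, S.orderEmbOfFin hS j = y i := fun i => by
    have := hy i
    rw [← Finset.mem_coe, ← Finset.range_orderEmbOfFin S hS] at this
    exact this
  choose f hf using hf
  have hfy : ∀ i j, y i < y j → f i < f j := fun i j h => by
    rw [← hf, ← hf] at h; simpa using h
  have hkey : ∀ i, (f i : ℕ) * n + i < M * n := fun i =>
    calc (f i : ℕ) * n + i < (f i + 1) * n := by rw [add_mul]; omega
      _ ≤ M * n := Nat.mul_le_mul_right n (f i).2
  -- Point `i` takes place number `i` of the block of its target. Below, `θ i` is the rank of this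
  -- place and `ρ` is the pattern of `β` on the places taken.
  let key : Fin n → Fin (M * n) := fun i => ⟨(f i : ℕ) * n + i, hkey i⟩
  have hkeylt : ∀ i j, f i < f j → key i < key j := fun i j h => by
    rw [Fin.lt_def]
    have : ((f i : ℕ) + 1) * n ≤ f j * n := Nat.mul_le_mul_right n h
    rw [add_mul] at this
    simp only [key]
    omega
  have hkeyinj : Function.Injective key := by
    intro i j hij
    rcases lt_trichotomy (f i) (f j) with h | h | h
    · exact absurd hij (hkeylt _ _ h).ne
    · simp only [key, Fin.mk.injEq, h] at hij
      exact Fin.ext (by omega)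
    · exact absurd hij (hkeylt _ _ h).ne'
  obtain ⟨θ, hθ⟩ := exists_perm_lt_iff hkeyinj
  obtain ⟨ρ, hρ⟩ := exists_perm_lt_iff (g := fun r => β (key (θ.symm r)))
    (β.injective.comp (hkeyinj.comp θ.symm.injective))
  have hρP : ρ ∈ P n := by
    refine hP _ _ _ _ hβ ⟨OrderEmbedding.ofStrictMono (fun r => key (θ.symm r)) ?_, ?_⟩
    · intro r r' h
      rw [← hθ]
      simpa using h
    · intro r r'
      exact (hρ r r').symm
  have hval : ∀ i j, π (y i) < π (y j) → ρ (θ i) < ρ (θ j) := by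
    intro i j h
    rw [hρ]
    simp only [Equiv.symm_apply_apply]
    have hne : f i ≠ f j := fun e => by
      rw [← hf, ← hf, e] at h
      exact lt_irrefl _ h
    rw [hcmp (f j) (f i) (key j) (key i) hne.symm (by simp [key]) (by simp [key])
      (by simp [key]) (by simp [key]), inducedPerm_lt_iff, hf, hf]
    exact h
  refine ⟨ρ, hρP, mul_le_mul_of_nonneg_left ?_ (by positivity)⟩
  refine (ciInf_le ⟨0, by rintro _ ⟨x, rfl⟩; positivity⟩ θ).trans ?_
  rw [Finset.sum_add_distrib, Finset.sum_add_distrib, mul_add]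
  exact add_le_add
    (sum_abs_sub_le_two_mul y θ (Equiv.refl _) fun i j h => (hθ i j).2 (hkeylt _ _ (hfy i j h)))
    (sum_abs_sub_le_two_mul (fun i => π (y i)) (θ.trans ρ) π fun i j h => hval i j h)

/-! ### Grids at dyadic scales. -/

/-- The cell of the point `(x, π x)` when positions and values are divided into `G` groups. -/
def gridCell {n : ℕ} (G : ℕ) (π : Equiv.Perm (Fin n)) (x : Fin n) : ℕ × ℕ :=
  ((x : ℕ) * G / n, (π x : ℕ) * G / n)

theorem fin_mul_div_lt {n G : ℕ} (hG : 0 < G) (x : Fin n) : (x : ℕ) * G / n < G :=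
  Nat.div_lt_of_lt_mul (Nat.mul_lt_mul_of_pos_right x.2 hG)

theorem fin_lt_of_mul_div_lt {n G : ℕ} {x y : Fin n} (h : (x : ℕ) * G / n < (y : ℕ) * G / n) :
    x < y := by
  by_contra hc
  have : (y : ℕ) ≤ x := not_lt.1 hc
  exact absurd h (not_lt.2 (Nat.div_le_div_right (Nat.mul_le_mul_right G this)))

theorem sub_mul_lt_of_mul_div_eq {n G : ℕ} {x y : Fin n} (h : (x : ℕ) * G / n = (y : ℕ) * G / n) :
    (y : ℕ) * G < x * G + n := by
  have hn : 0 < n := x.pos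
  have h1 := Nat.lt_div_mul_add (a := (y : ℕ) * G) hn
  have h2 := Nat.div_mul_le_self ((x : ℕ) * G) n
  rw [← h] at h1
  omega

theorem abs_sub_le_of_mul_div_eq {n G : ℕ} (hG : 0 < G) {x y : Fin n}
    (h : (x : ℕ) * G / n = (y : ℕ) * G / n) : |((x : ℕ) : ℝ) - ((y : ℕ) : ℝ)| ≤ n / G := by
  have hG' : (0 : ℝ) < G := by exact_mod_cast hG
  rw [le_div_iff₀ hG']
  have h1 : ((y : ℕ) : ℝ) * G < x * G + n := by exact_mod_cast sub_mul_lt_of_mul_div_eq h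
  have h2 : ((x : ℕ) : ℝ) * G < y * G + n := by exact_mod_cast sub_mul_lt_of_mul_div_eq h.symm
  rcases abs_cases (((x : ℕ) : ℝ) - ((y : ℕ) : ℝ)) with ⟨e, -⟩ | ⟨e, -⟩ <;> rw [e] <;> linarith

/-- Points in different rows and columns compare as their cells do, so a copy of `σ` among the hit
cells would give one in the sample. -/
theorem card_image_gridCell_le {n M s G : ℕ} (hG : 0 < G) {σ : Equiv.Perm (Fin s)}
    {π : Equiv.Perm (Fin n)} {S : Finset (Fin n)} (hS : S.card = M)
    (h : ¬ IsSubpermutation σ (inducedPerm π S hS)) :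
    (S.image (gridCell G π)).card ≤ exNumber G σ := by
  classical
  let A : Matrix (Fin G) (Fin G) Bool :=
    Matrix.of fun a b => decide (((a : ℕ), (b : ℕ)) ∈ S.image (gridCell G π))
  have hA : ¬ MatrixContains A (permZeroOneMatrix σ) := by
    rw [matrixContains_perm_iff]
    rintro ⟨r, c, hr, hc, hrc⟩
    have : ∀ i, ∃ x ∈ S, gridCell G π x = ((r i : ℕ), (c (σ i) : ℕ)) := fun i => by
      simpa [A] using hrc i
    choose x hxS hx using this
    simp only [gridCell, Prod.mk.injEq] at hx
    refine h (isSubpermutation_inducedPerm σ π S hS x (fun i j hij => ?_) hxS fun i j hij => ?_)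
    · apply fin_lt_of_mul_div_lt (G := G)
      rw [(hx i).1, (hx j).1]
      exact hr hij
    · apply fin_lt_of_mul_div_lt (G := G)
      rw [(hx i).2, (hx j).2]
      exact hc hij
  refine le_trans ?_ (numOnes_le_exNumber hA)
  refine (Finset.card_le_card ?_).trans (Finset.card_image_le
    (f := fun p : Fin G × Fin G => ((p.1 : ℕ), (p.2 : ℕ))))
  intro p hp
  obtain ⟨x, hx, rfl⟩ := Finset.mem_image.1 hp
  exact Finset.mem_image.2 ⟨(⟨_, fin_mul_div_lt hG x⟩, ⟨_, fin_mul_div_lt hG (π x)⟩),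
    Finset.mem_filter.2 ⟨Finset.mem_univ _, decide_eq_true hp⟩, rfl⟩

/-- Use the finest scale at which the cell of `x` is hit; scale `0` has one cell and always
qualifies. If scale `j < l` is used, the cost `2n/2^j = 4n/2^(j+1)` is charged to the uncovered
scale `j + 1`. -/
theorem exists_mem_near {n : ℕ} (π : Equiv.Perm (Fin n)) {S : Finset (Fin n)} (hS : S.Nonempty)
    (x : Fin n) (l : ℕ) :
    ∃ y ∈ S, |((x : ℕ) : ℝ) - ((y : ℕ) : ℝ)| + |((π x : ℕ) : ℝ) - ((π y : ℕ) : ℝ)| ≤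
      2 * n / 2 ^ l + ∑ i ∈ Finset.Icc 1 l,
        if x ∈ uncovered (gridCell (2 ^ i) π) S then 4 * (n : ℝ) / 2 ^ i else 0 := by
  have same : ∀ (l : ℕ) (y : Fin n), gridCell (2 ^ l) π y = gridCell (2 ^ l) π x →
      |((x : ℕ) : ℝ) - ((y : ℕ) : ℝ)| + |((π x : ℕ) : ℝ) - ((π y : ℕ) : ℝ)| ≤ 2 * n / 2 ^ l := by
    intro l y h
    simp only [gridCell, Prod.mk.injEq] at h
    have h1 := abs_sub_le_of_mul_div_eq (by positivity) h.1.symm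
    have h2 := abs_sub_le_of_mul_div_eq (by positivity) h.2.symm
    push_cast at h1 h2
    rw [two_mul, add_div]
    exact add_le_add h1 h2
  induction l with
  | zero =>
    obtain ⟨y, hy⟩ := hS
    refine ⟨y, hy, (same 0 y ?_).trans (by simp)⟩
    simp [gridCell, Nat.div_eq_of_lt]
  | succ l ih =>
    rw [Finset.sum_Icc_succ_top (by omega)]
    have hnn : 0 ≤ ∑ i ∈ Finset.Icc 1 l,
        if x ∈ uncovered (gridCell (2 ^ i) π) S then 4 * (n : ℝ) / 2 ^ i else 0 :=
      Finset.sum_nonneg fun i _ => by split_ifs <;> positivity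
    by_cases hx : x ∈ uncovered (gridCell (2 ^ (l + 1)) π) S
    · obtain ⟨y, hy, h⟩ := ih
      refine ⟨y, hy, h.trans ?_⟩
      rw [if_pos hx]
      have e : 4 * (n : ℝ) / 2 ^ (l + 1) = 2 * n / 2 ^ l := by
        rw [pow_succ]; field_simp; ring
      have : (0 : ℝ) ≤ 2 * n / 2 ^ (l + 1) := by positivity
      rw [e]
      linarith
    · rw [if_neg hx]
      simp only [uncovered, Finset.mem_filter, Finset.mem_univ, true_and, not_not,
        Finset.mem_image] at hx
      obtain ⟨y, hy, h⟩ := hx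
      exact ⟨y, hy, (same _ y h).trans (by linarith)⟩

theorem one_sub_le_sampleProb {n M : ℕ} (hMn : M ≤ n) (π : Equiv.Perm (Fin n))
    {E : Equiv.Perm (Fin M) → Prop} {ε : ℝ} {B : Finset (Finset (Fin n))}
    (hB : ∀ (S : Finset (Fin n)) (hS : S.card = M), ¬ E (inducedPerm π S hS) → S ∈ B)
    (hcard : (B.card : ℝ) ≤ ε * n.choose M) : 1 - ε ≤ sampleProb M π E := by
  classical
  have htot : Fintype.card {S : Finset (Fin n) // S.card = M} = n.choose M := by simp
  rw [sampleProb, Nat.card_eq_fintype_card, Nat.card_eq_fintype_card, htot, Fintype.card_subtype]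
  have h0 : (0 : ℝ) < n.choose M := by exact_mod_cast Nat.choose_pos hMn
  rw [le_div_iff₀ h0]
  have h1 := Finset.card_filter_add_card_filter_not (s := Finset.univ)
    (fun S : {S : Finset (Fin n) // S.card = M} => E (inducedPerm π S.1 S.2))
  rw [Finset.card_univ, htot] at h1
  have h2 : (Finset.univ.filter fun S : {S : Finset (Fin n) // S.card = M} =>
      ¬ E (inducedPerm π S.1 S.2)).card ≤ B.card :=
    Finset.card_le_card_of_injOn Subtype.val
      (fun S hS => hB S.1 S.2 (Finset.mem_filter.1 (Finset.mem_coe.1 hS)).2)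
      Subtype.val_injective.injOn
  have h3 : ((Finset.univ.filter fun S : {S : Finset (Fin n) // S.card = M} =>
      ¬ E (inducedPerm π S.1 S.2)).card : ℝ) ≤ B.card := by exact_mod_cast h2
  have h4 : ((Finset.univ.filter fun S : {S : Finset (Fin n) // S.card = M} =>
      E (inducedPerm π S.1 S.2)).card : ℝ) + (Finset.univ.filter fun S :
      {S : Finset (Fin n) // S.card = M} => ¬ E (inducedPerm π S.1 S.2)).card = n.choose M := by
    exact_mod_cast h1
  linarith

theorem sum_dist_le {n : ℕ} (π : Equiv.Perm (Fin n)) {S : Finset (Fin n)} (hS : S.Nonempty)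
    (l : ℕ) {u : ℕ → ℝ}
    (hu : ∀ i ∈ Finset.Icc 1 l, ((uncovered (gridCell (2 ^ i) π) S).card : ℝ) ≤ u i) :
    ∃ y : Fin n → Fin n, (∀ x, y x ∈ S) ∧
      ∑ x : Fin n, (|((x : ℕ) : ℝ) - ((y x : ℕ) : ℝ)| + |((π x : ℕ) : ℝ) - ((π (y x) : ℕ) : ℝ)|) ≤
        n * (2 * n / 2 ^ l) + ∑ i ∈ Finset.Icc 1 l, u i * (4 * n / 2 ^ i) := by
  choose y hy h using fun x => exists_mem_near π hS x l
  refine ⟨y, hy, (Finset.sum_le_sum fun x _ => h x).trans ?_⟩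
  rw [Finset.sum_add_distrib, Finset.sum_comm]
  refine add_le_add (by simp) (Finset.sum_le_sum fun i hi => ?_)
  rw [← Finset.sum_filter, Finset.sum_const, nsmul_eq_mul]
  refine mul_le_mul_of_nonneg_right ?_ (by positivity)
  rw [Finset.filter_univ_mem]
  exact hu i hi

/-! ### Far permutations are rejected. -/

theorem one_sub_le_sampleProb_not_testerAccepts {P : PermProperty} (hP : P.Hereditary) {s : ℕ}
    (hs : 2 ≤ s) {σ : Equiv.Perm (Fin s)} (hσ : σ ∉ P s) {ε : ℝ} (hε : 0 < ε) (hε1 : ε ≤ 1)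
    {M : ℕ} (hM1 : 1 ≤ M)
    (hM : 2000 * furediHajnal σ * Real.logb 2 (2 / ε) ^ 2 / ε ≤ (M : ℝ)) {n : ℕ} (hn : 2 ≤ n)
    (hMn : M ≤ n) (π : Equiv.Perm (Fin n)) (hfar : ∀ ρ ∈ P n, ε < earthMoverDist π ρ) :
    1 - ε ≤ sampleProb M π (fun α => ¬ TesterAccepts P α) := by
  classical
  set c := furediHajnal σ with hc
  have hc1 : 1 ≤ c := by
    have h1 := sub_one_le_furediHajnal hs σ
    have h2 : (2 : ℝ) ≤ s := by exact_mod_cast hs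
    linarith
  set Λ := Real.logb 2 (2 / ε) with hΛ
  have hpow : (2 : ℝ) ^ Λ = 2 / ε := Real.rpow_logb (by norm_num) (by norm_num) (by positivity)
  have hΛ1 : 1 ≤ Λ := by
    rw [hΛ, Real.le_logb_iff_rpow_le (by norm_num) (by positivity), Real.rpow_one,
      le_div_iff₀ hε]
    linarith
  have hexp : 2 * Real.exp (-Λ) ≤ ε := by
    have h1 : (2 : ℝ) ≤ Real.exp 1 := by
      have := Real.add_one_le_exp (1 : ℝ)
      linarith
    have h2 : (2 : ℝ) ^ Λ ≤ Real.exp Λ := by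
      rw [← Real.exp_one_rpow]
      exact Real.rpow_le_rpow (by norm_num) h1 (by linarith)
    rw [hpow, div_le_iff₀ hε] at h2
    rw [Real.exp_neg, ← div_eq_mul_inv, div_le_iff₀ (Real.exp_pos _)]
    linarith
  -- Enough scales for the finest one to cost at most `ε n^2 / 16` in total, yet at most `6 Λ` of
  -- them since `1 ≤ Λ`.
  set l := ⌈Λ⌉₊ + 4 with hl
  have hl6 : (l : ℝ) ≤ 6 * Λ := by
    have := Nat.ceil_lt_add_one (show 0 ≤ Λ by linarith)
    rw [hl]; push_cast; linarith
  have hl1 : (1 : ℝ) ≤ l := by rw [hl]; push_cast; linarith [Nat.cast_nonneg (α := ℝ) ⌈Λ⌉₊]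
  have hl2 : 32 / ε ≤ (2 : ℝ) ^ l := by
    have h1 : (2 : ℝ) ^ Λ ≤ 2 ^ ⌈Λ⌉₊ := by
      rw [← Real.rpow_natCast]
      exact Real.rpow_le_rpow_of_exponent_le (by norm_num) (Nat.le_ceil _)
    rw [hpow] at h1
    rw [hl, pow_add, show 32 / ε = 2 / ε * 2 ^ 4 by ring]
    gcongr
  have hn0 : (2 : ℝ) ≤ n := by exact_mod_cast hn
  -- The allowed uncovered fraction is chosen so that every scale contributes the same `ε n^2 / (16
  -- l)`.
  let δ : ℕ → ℝ := fun i => ε * 2 ^ i / (64 * l)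
  have hδ0 : ∀ i, 0 ≤ δ i := fun i => by positivity
  let B : ℕ → Finset (Finset (Fin n)) := fun i =>
    (Finset.powersetCard M Finset.univ).filter fun S : Finset (Fin n) =>
      (S.image (gridCell (2 ^ i) π)).card ≤ exNumber (2 ^ i) σ ∧
        δ i * Fintype.card (Fin n) < (uncovered (gridCell (2 ^ i) π) S).card
  have hBcard : ∀ i ∈ Finset.Icc 1 l, ((B i).card : ℝ) ≤ n.choose M * Real.exp (-(3.2 * Λ)) := by
    intro i hi
    have hi1 := (Finset.mem_Icc.1 hi).1
    rcases le_or_gt (δ i) 1 with hδ1 | hδ1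
    · refine (card_uncovered_gt_le (gridCell (2 ^ i) π) (hδ0 i) hδ1 M (exNumber (2 ^ i) σ)).trans ?_
      rw [Fintype.card_fin]
      refine mul_le_mul_of_nonneg_left (Real.exp_le_exp.2 ?_) (by positivity)
      have hm : (exNumber (2 ^ i) σ : ℝ) ≤ c * 2 ^ i := by
        have := exNumber_le_furediHajnal_mul hs σ (n := 2 ^ i) (by positivity)
        push_cast at this
        exact this
      have h2i : (2 : ℝ) ≤ 2 ^ i := by
        calc (2 : ℝ) = 2 ^ 1 := by norm_num
          _ ≤ 2 ^ i := pow_le_pow_right₀ (by norm_num) hi1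
      -- Source of the constant `2000`: `2000 / 128 ≥ 2.6 * 6`. The exponent is then at most `-1.6 Λ
      -- c 2^i ≤ -3.2 Λ`.
      have hδM : 2.6 * Λ * (c * 2 ^ i) ≤ δ i * M / 2 := by
        have h1 : δ i * (2000 * c * Λ ^ 2 / ε) / 2 ≤ δ i * M / 2 := by
          have := mul_le_mul_of_nonneg_left hM (hδ0 i)
          linarith
        refine le_trans ?_ h1
        have h2 : δ i * (2000 * c * Λ ^ 2 / ε) / 2 = 2000 / 128 * (c * 2 ^ i) * Λ ^ 2 / l := by
          simp only [δ]; field_simp; ring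
        rw [h2, le_div_iff₀ (by linarith)]
        have h3 : 2.6 * Λ * (c * 2 ^ i) * l ≤ 2.6 * Λ * (c * 2 ^ i) * (6 * Λ) := by
          gcongr
        nlinarith [show 0 ≤ (c * 2 ^ i) * Λ ^ 2 by positivity]
      have h2 : 2 ≤ c * 2 ^ i := by nlinarith
      have h3 : 1.6 * Λ * 2 ≤ 1.6 * Λ * (c * 2 ^ i) := by gcongr
      nlinarith
    · have : B i = ∅ := by
        refine Finset.filter_eq_empty_iff.2 fun S _ hS => ?_
        have h1 : ((uncovered (gridCell (2 ^ i) π) S).card : ℝ) ≤ Fintype.card (Fin n) := by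
          exact_mod_cast Finset.card_le_univ _
        have h2 : (Fintype.card (Fin n) : ℝ) ≤ δ i * Fintype.card (Fin n) :=
          le_mul_of_one_le_left (by positivity) hδ1.le
        linarith [hS.2]
      rw [this]
      simp only [Finset.card_empty, Nat.cast_zero]
      positivity
  refine one_sub_le_sampleProb hMn π (B := (Finset.Icc 1 l).biUnion B) ?_ ?_
  · intro S hS hacc
    rw [not_not] at hacc
    by_contra hSB
    simp only [Finset.mem_biUnion, not_exists, not_and] at hSB
    have hS0 : S.Nonempty := Finset.card_pos.1 (by omega)
    have hsub : ¬ IsSubpermutation σ (inducedPerm π S hS) := fun h =>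
      hσ (hP _ _ _ _ (hacc.mem hP) h)
    have hu : ∀ i ∈ Finset.Icc 1 l,
        ((uncovered (gridCell (2 ^ i) π) S).card : ℝ) ≤ δ i * n := by
      intro i hi
      by_contra hlt
      refine hSB i hi (Finset.mem_filter.2 ⟨Finset.mem_powersetCard.2 ⟨Finset.subset_univ _, hS⟩,
        card_image_gridCell_le (by positivity) hS hsub, ?_⟩)
      rw [Fintype.card_fin]
      exact not_le.1 hlt
    obtain ⟨y, hyS, hy⟩ := sum_dist_le π hS0 l hu
    obtain ⟨ρ, hρ, hd⟩ := exists_mem_earthMoverDist_le hP (by omega) π S hS hacc y hyS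
    refine absurd (hfar ρ hρ) (not_lt.2 (hd.trans ?_))
    have hch : (n.choose 2 : ℝ) = n * (n - 1) / 2 := Nat.cast_choose_two ℝ n
    have hpos : (0 : ℝ) < n.choose 2 := by
      rw [hch]
      have : (0 : ℝ) < n - 1 := by linarith
      positivity
    rw [one_div, inv_mul_le_iff₀ hpos, hch]
    have hs1 : ∑ i ∈ Finset.Icc 1 l, δ i * n * (4 * n / 2 ^ i) = ε * n ^ 2 / 16 := by
      have : ∀ i ∈ Finset.Icc 1 l, δ i * n * (4 * n / 2 ^ i) = ε * n ^ 2 / 16 / l := by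
        intro i _
        simp only [δ]
        field_simp
        norm_num
      rw [Finset.sum_congr rfl this, Finset.sum_const, Nat.card_Icc, nsmul_eq_mul]
      simp only [Nat.add_sub_cancel]
      field_simp
    have hs2 : (n : ℝ) * (2 * n / 2 ^ l) ≤ ε * n ^ 2 / 16 := by
      have h1 : 2 * (n : ℝ) / 2 ^ l ≤ 2 * n / (32 / ε) := by gcongr
      calc (n : ℝ) * (2 * n / 2 ^ l) ≤ n * (2 * n / (32 / ε)) := by gcongr
        _ = ε * n ^ 2 / 16 := by field_simp; ring
    -- The moves cost at most `ε n^2 / 8`; doubled, this is `ε n^2 / 4 ≤ ε n (n - 1) / 2` because `2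
    -- ≤ n`.
    rw [hs1] at hy
    have : 0 ≤ ε * n * (n - 2) := mul_nonneg (by positivity) (by linarith)
    nlinarith
  · have h1 : (((Finset.Icc 1 l).biUnion B).card : ℝ) ≤
        ∑ i ∈ Finset.Icc 1 l, ((B i).card : ℝ) := by
      exact_mod_cast Finset.card_biUnion_le
    refine h1.trans ((Finset.sum_le_sum hBcard).trans ?_)
    rw [Finset.sum_const, Nat.card_Icc, nsmul_eq_mul, Nat.add_sub_cancel]
    -- Union bound over the scales: `l ≤ 6 Λ ≤ 2 exp(2.2 Λ)` leaves `2 exp(-Λ) ≤ ε`.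
    have h2 : (l : ℝ) * Real.exp (-(3.2 * Λ)) ≤ ε := by
      refine le_trans ?_ hexp
      have h3 : 1.1 * Λ + 1 ≤ Real.exp (1.1 * Λ) := Real.add_one_le_exp _
      have h4 : 3 * Λ ≤ Real.exp (2.2 * Λ) := by
        rw [show 2.2 * Λ = 1.1 * Λ + 1.1 * Λ by ring, Real.exp_add]
        nlinarith
      have h5 : Real.exp (-(3.2 * Λ)) = Real.exp (-Λ) / Real.exp (2.2 * Λ) := by
        rw [← Real.exp_sub]; ring_nf
      rw [h5, mul_div_assoc', div_le_iff₀ (Real.exp_pos _)]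
      nlinarith [Real.exp_pos (-Λ)]
    nlinarith [Nat.cast_nonneg (α := ℝ) (n.choose M)]

/-! ### Members of the property are accepted. -/

theorem card_powersetCard_filter_superset_le {X : Type*} [Fintype X] [DecidableEq X] (T : Finset X)
    (M : ℕ) : ((Finset.powersetCard M Finset.univ).filter fun S => T ⊆ S).card ≤
      (Fintype.card X - T.card).choose (M - T.card) := by
  rw [← Finset.card_compl, ← Finset.card_powersetCard]
  refine Finset.card_le_card_of_injOn (fun S => S \ T) ?_ ?_
  · intro S hS
    obtain ⟨h1, h2⟩ := Finset.mem_filter.1 (Finset.mem_coe.1 hS)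
    refine Finset.mem_coe.2 (Finset.mem_powersetCard.2 ⟨fun x hx => ?_, ?_⟩)
    · exact Finset.mem_compl.2 (Finset.mem_sdiff.1 hx).2
    · rw [Finset.card_sdiff_of_subset h2, (Finset.mem_powersetCard.1 h1).2]
  · intro S hS S' hS' h
    have h1 := (Finset.mem_filter.1 (Finset.mem_coe.1 hS)).2
    have h2 := (Finset.mem_filter.1 (Finset.mem_coe.1 hS')).2
    rw [← Finset.sdiff_union_of_subset h1, ← Finset.sdiff_union_of_subset h2]
    exact congrArg (· ∪ T) h

/-- Positions in one group differ by at most `(n - 1) / G`. Leaving out `x` absorbs the extra one,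
and the numerator `n - 1` later cancels in the count of sets containing a pair. -/
theorem card_filter_ne_mul_div_eq_le {n : ℕ} (G : ℕ) (hG : 0 < G) (x : Fin n) :
    (Finset.univ.filter fun y : Fin n => x ≠ y ∧ (x : ℕ) * G / n = (y : ℕ) * G / n).card ≤
      (n - 1) / G := by
  set T := Finset.univ.filter fun y : Fin n => (x : ℕ) * G / n = (y : ℕ) * G / n with hT
  have hx : x ∈ T := by simp [hT]
  have hne : T.Nonempty := ⟨x, hx⟩
  have e : (Finset.univ.filter fun y : Fin n => x ≠ y ∧ (x : ℕ) * G / n = (y : ℕ) * G / n) =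
      T.erase x := by
    ext y; simp [hT, ne_comm]
  rw [e, Finset.card_erase_of_mem hx]
  obtain ⟨m, hmT, hmle⟩ : ∃ m ∈ T, ∀ y ∈ T, m ≤ y :=
    ⟨T.min' hne, T.min'_mem hne, fun y hy => T.min'_le y hy⟩
  have hsub : T.map Fin.valEmbedding ⊆ Finset.Icc (m : ℕ) ((m : ℕ) + (n - 1) / G) := by
    intro z hz
    obtain ⟨y, hy, rfl⟩ := Finset.mem_map.1 hz
    have h1 : (m : ℕ) ≤ y := hmle y hy
    refine Finset.mem_Icc.2 ⟨h1, ?_⟩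
    simp only [hT, Finset.mem_filter, Finset.mem_univ, true_and] at hy hmT
    have h2 := sub_mul_lt_of_mul_div_eq (hmT.symm.trans hy)
    have h3 : (y : ℕ) - (m : ℕ) ≤ (n - 1) / G := by
      rw [Nat.le_div_iff_mul_le hG, Nat.sub_mul]
      omega
    exact Nat.sub_le_iff_le_add'.1 h3
  have := Finset.card_le_card hsub
  rw [Finset.card_map, Nat.card_Icc] at this
  generalize (n - 1) / G = q at this ⊢
  omega

theorem mul_div_order_congr {n G : ℕ} {x y x' y' : Fin n}
    (hne : (x : ℕ) * G / n ≠ (y : ℕ) * G / n) (hx : (x' : ℕ) * G / n = (x : ℕ) * G / n)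
    (hy : (y' : ℕ) * G / n = (y : ℕ) * G / n) : x' < y' ↔ x < y := by
  have key : ∀ u v : Fin n, (u : ℕ) * G / n ≠ (v : ℕ) * G / n →
      (u < v ↔ (u : ℕ) * G / n < (v : ℕ) * G / n) := fun u v huv =>
    ⟨fun h => lt_of_le_of_ne
      (Nat.div_le_div_right (Nat.mul_le_mul_right G (Fin.le_def.1 h.le))) huv,
      fin_lt_of_mul_div_lt⟩
  rw [key x y hne, key x' y' (by rw [hx, hy]; exact hne), hx, hy]

/-- If the points of a sample lie in pairwise different rows and columns of a grid, in cells with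
at least `k` points each, then the sampled permutation has a `k`-blow-up in the property. -/
theorem hasKBlowUpIn_of_heavy_cells {P : PermProperty} (hP : P.Hereditary) {n M k G : ℕ}
    (hk : 0 < k) {π : Equiv.Perm (Fin n)} (hπ : π ∈ P n) {S : Finset (Fin n)} (hS : S.card = M)
    (hheavy : ∀ x ∈ S, k ≤ (Finset.univ.filter fun y => gridCell G π y = gridCell G π x).card)
    (hpos : ∀ x ∈ S, ∀ y ∈ S, x ≠ y → (x : ℕ) * G / n ≠ (y : ℕ) * G / n)
    (hval : ∀ x ∈ S, ∀ y ∈ S, x ≠ y → (π x : ℕ) * G / n ≠ (π y : ℕ) * G / n) :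
    HasKBlowUpIn P k (inducedPerm π S hS) := by
  let x : Fin M ↪o Fin n := S.orderEmbOfFin hS
  have hxS : ∀ j, x j ∈ S := fun j => S.orderEmbOfFin_mem hS j
  let e : Fin M → Fin k ↪o Fin n := fun j => Finset.orderEmbOfCardLe _ (hheavy (x j) (hxS j))
  have he : ∀ j b, gridCell G π (e j b) = gridCell G π (x j) := fun j b =>
    (Finset.mem_filter.1 (Finset.orderEmbOfCardLe_mem _ (hheavy (x j) (hxS j)) b)).2
  -- The points chosen in the cells, listed cell by cell in the order of the sample.
  let g : Fin (M * k) → Fin n := fun i => e i.divNat i.modNat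
  have hgpos : ∀ i, (g i : ℕ) * G / n = (x i.divNat : ℕ) * G / n := fun i =>
    congrArg Prod.fst (he i.divNat i.modNat)
  have hgval : ∀ i, (π (g i) : ℕ) * G / n = (π (x i.divNat) : ℕ) * G / n := fun i =>
    congrArg Prod.snd (he i.divNat i.modNat)
  have hg : StrictMono g := by
    intro i i' hii
    have hd : (i : ℕ) / k ≤ i' / k := Nat.div_le_div_right (Fin.le_def.1 hii.le)
    by_cases h : i.divNat = i'.divNat
    · simp only [g, h]
      refine (e i'.divNat).strictMono ?_
      rw [Fin.lt_def]
      have h' : (i : ℕ) / k = i' / k := by simpa [Fin.ext_iff] using h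
      have h1 := Nat.div_add_mod (i : ℕ) k
      have h2 := Nat.div_add_mod (i' : ℕ) k
      rw [h'] at h1
      have h3 : (i : ℕ) < i' := hii
      change (i : ℕ) % k < i' % k
      omega
    · have hlt : i.divNat < i'.divNat := lt_of_le_of_ne (by rw [Fin.le_def]; simpa using hd) h
      rw [mul_div_order_congr (hpos _ (hxS _) _ (hxS _) (x.injective.ne h)) (hgpos i) (hgpos i')]
      exact x.strictMono hlt
  obtain ⟨β, hβ⟩ := exists_perm_lt_iff (g := fun i => π (g i)) (π.injective.comp hg.injective)
  have hdiv : ∀ (j : Fin M) (i : Fin (M * k)), (j : ℕ) * k ≤ i → (i : ℕ) < (j + 1) * k →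
      i.divNat = j := fun j i h1 h2 => by
    ext
    exact Nat.div_eq_of_lt_le h1 h2
  refine ⟨M * k, β, ⟨fun j => j * k, ⟨?_, by simp, by simp, ?_⟩, ?_⟩, ?_⟩
  · exact fun i j hij => Nat.mul_lt_mul_of_pos_right hij hk
  · intro j₁ j₂ i₁ i₂ hne h1 h2 h3 h4
    have e1 := hdiv j₁ i₁ (by simpa using h1) (by simpa using h2)
    have e2 := hdiv j₂ i₂ (by simpa using h3) (by simpa using h4)
    rw [hβ, inducedPerm_lt_iff]
    exact mul_div_order_congr (hval _ (hxS _) _ (hxS _) (x.injective.ne hne.symm))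
      (by rw [hgval, e2]) (by rw [hgval, e1])
  · intro j
    simp [add_mul]
  · exact hP _ _ _ _ hπ ⟨OrderEmbedding.ofStrictMono g hg, fun i j => (hβ i j).symm⟩

theorem one_sub_le_sampleProb_testerAccepts {P : PermProperty} (hP : P.Hereditary) {ε : ℝ}
    (hε : 0 < ε) (hε1 : ε ≤ 1) {n M K : ℕ} (hM : 2 ≤ M) (hMn : M ≤ n)
    (hn : 32 * (M : ℝ) ^ 5 * K / ε ^ 3 ≤ n)
    (hK : ∀ α : Equiv.Perm (Fin M), ¬ TesterAccepts P α →
      ∃ k, 0 < k ∧ k ≤ K ∧ ¬ HasKBlowUpIn P k α)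
    {π : Equiv.Perm (Fin n)} (hπ : π ∈ P n) :
    1 - ε ≤ sampleProb M π (fun α => TesterAccepts P α) := by
  classical
  have hM0 : (2 : ℝ) ≤ M := by exact_mod_cast hM
  -- Large enough that a shared row or column has probability at most `2M(M-1)/G ≤ ε/2`. Small
  -- enough that hitting a light cell has probability at most `K G² M / n ≤ 16 M⁵ K / (ε² n) ≤ ε/2`;
  -- this dictates the bound on `n`.
  set G := ⌊4 * (M : ℝ) ^ 2 / ε⌋₊ with hGdef
  have hG1 : (G : ℝ) ≤ 4 * M ^ 2 / ε := Nat.floor_le (by positivity)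
  have hG2 : 4 * (M : ℝ) * (M - 1) ≤ ε * G := by
    have h1 := (Nat.lt_floor_add_one (4 * (M : ℝ) ^ 2 / ε)).le
    rw [← hGdef, div_le_iff₀ hε] at h1
    nlinarith
  have hGpos' : (0 : ℝ) < G := by nlinarith
  have hGpos : 0 < G := by exact_mod_cast hGpos'
  let light : Finset (Fin n) := Finset.univ.filter fun x =>
    (Finset.univ.filter fun y => gridCell G π y = gridCell G π x).card < K
  have hlight : light.card ≤ K * (G * G) := by
    have := Finset.card_le_mul_card_image_of_maps_to (s := light) (f := gridCell G π)
      (t := Finset.range G ×ˢ Finset.range G)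
      (fun x _ => Finset.mem_product.2 ⟨Finset.mem_range.2 (fin_mul_div_lt hGpos x),
        Finset.mem_range.2 (fin_mul_div_lt hGpos (π x))⟩) K (fun b _ => by
        rcases Finset.eq_empty_or_nonempty (light.filter fun a => gridCell G π a = b) with h | h
        · rw [h]; simp
        · obtain ⟨a, ha⟩ := h
          obtain ⟨ha1, rfl⟩ := Finset.mem_filter.1 ha
          refine le_trans (Finset.card_le_card ?_) (Finset.mem_filter.1 ha1).2.le
          exact Finset.filter_subset_filter _ (Finset.subset_univ _))
    simpa using this
  let pairs : Finset (Fin n × Fin n) := Finset.univ.filter fun p =>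
    p.1 ≠ p.2 ∧ ((p.1 : ℕ) * G / n = (p.2 : ℕ) * G / n ∨
      (π p.1 : ℕ) * G / n = (π p.2 : ℕ) * G / n)
  have hpairs : pairs.card ≤ 2 * (n * ((n - 1) / G)) := by
    have hsub : pairs ⊆ (Finset.univ.filter fun p : Fin n × Fin n =>
        p.1 ≠ p.2 ∧ (p.1 : ℕ) * G / n = (p.2 : ℕ) * G / n) ∪
        Finset.univ.filter fun p : Fin n × Fin n =>
          p.1 ≠ p.2 ∧ (π p.1 : ℕ) * G / n = (π p.2 : ℕ) * G / n := by
      intro p hp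
      obtain ⟨-, h1, h2⟩ := Finset.mem_filter.1 hp
      rw [Finset.mem_union]
      exact h2.imp (fun h => Finset.mem_filter.2 ⟨Finset.mem_univ _, h1, h⟩)
        fun h => Finset.mem_filter.2 ⟨Finset.mem_univ _, h1, h⟩
    have h1 : (Finset.univ.filter fun p : Fin n × Fin n =>
        p.1 ≠ p.2 ∧ (p.1 : ℕ) * G / n = (p.2 : ℕ) * G / n).card ≤ n * ((n - 1) / G) := by
      rw [Finset.card_filter, Fintype.sum_prod_type]
      refine (Finset.sum_le_card_nsmul _ _ ((n - 1) / G) fun x _ => ?_).trans (by simp)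
      rw [← Finset.card_filter]
      exact card_filter_ne_mul_div_eq_le G hGpos x
    have h2 : (Finset.univ.filter fun p : Fin n × Fin n =>
        p.1 ≠ p.2 ∧ (π p.1 : ℕ) * G / n = (π p.2 : ℕ) * G / n).card ≤ n * ((n - 1) / G) := by
      refine le_trans (Finset.card_le_card_of_injOn (fun p => (π p.1, π p.2)) ?_ ?_) h1
      · intro p hp
        obtain ⟨-, h1, h2⟩ := Finset.mem_filter.1 (Finset.mem_coe.1 hp)
        exact Finset.mem_coe.2 (Finset.mem_filter.2
          ⟨Finset.mem_univ _, fun h => h1 (π.injective h), h2⟩)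
      · rintro ⟨a, b⟩ - ⟨c, d⟩ - h
        simpa using h
    have := (Finset.card_le_card hsub).trans (Finset.card_union_le _ _)
    omega
  let pc := Finset.powersetCard M (Finset.univ : Finset (Fin n))
  let B₁ := light.biUnion fun x => pc.filter fun S => {x} ⊆ S
  let B₂ := pairs.biUnion fun p => pc.filter fun S => {p.1, p.2} ⊆ S
  have hB₁ : B₁.card ≤ K * (G * G) * (n - 1).choose (M - 1) := by
    refine (Finset.card_biUnion_le_card_mul _ _ ((n - 1).choose (M - 1)) fun x _ => ?_).trans
      (Nat.mul_le_mul_right _ hlight)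
    simpa using card_powersetCard_filter_superset_le ({x} : Finset (Fin n)) M
  have hB₂ : B₂.card ≤ 2 * (n * ((n - 1) / G)) * (n - 2).choose (M - 2) := by
    refine (Finset.card_biUnion_le_card_mul _ _ ((n - 2).choose (M - 2)) fun p hp => ?_).trans
      (Nat.mul_le_mul_right _ hpairs)
    have := card_powersetCard_filter_superset_le ({p.1, p.2} : Finset (Fin n)) M
    rwa [Finset.card_pair (Finset.mem_filter.1 hp).2.1, Fintype.card_fin] at this
  refine one_sub_le_sampleProb hMn π (B := B₁ ∪ B₂) ?_ ?_
  · intro S hS hrej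
    by_contra hSB
    obtain ⟨k, hk0, hkK, hk⟩ := hK _ hrej
    rw [Finset.mem_union, not_or] at hSB
    have hSpc : S ∈ pc := Finset.mem_powersetCard.2 ⟨Finset.subset_univ _, hS⟩
    have hp : ∀ x ∈ S, ∀ y ∈ S, (x, y) ∉ pairs := fun x hx y hy hxy =>
      hSB.2 (Finset.mem_biUnion.2 ⟨_, hxy, Finset.mem_filter.2 ⟨hSpc, by
        intro z hz
        rcases Finset.mem_insert.1 hz with rfl | hz
        · exact hx
        · rw [Finset.mem_singleton.1 hz]; exact hy⟩⟩)
    refine hk (hasKBlowUpIn_of_heavy_cells (G := G) hP hk0 hπ hS (fun x hx => ?_)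
      (fun x hx y hy hxy h => ?_) fun x hx y hy hxy h => ?_)
    · by_contra hlt
      exact hSB.1 (Finset.mem_biUnion.2 ⟨x, Finset.mem_filter.2 ⟨Finset.mem_univ _, by omega⟩,
        Finset.mem_filter.2 ⟨hSpc, Finset.singleton_subset_iff.2 hx⟩⟩)
    · exact hp x hx y hy (Finset.mem_filter.2 ⟨Finset.mem_univ _, hxy, Or.inl h⟩)
    · exact hp x hx y hy (Finset.mem_filter.2 ⟨Finset.mem_univ _, hxy, Or.inr h⟩)
  · obtain ⟨n, rfl⟩ : ∃ n', n = n' + 2 := ⟨n - 2, by omega⟩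
    obtain ⟨M, rfl⟩ : ∃ M', M = M' + 2 := ⟨M - 2, by omega⟩
    -- These identities say that a given point is sampled with probability `M/n` and, together, a
    -- given pair with probability `M(M-1)/(n(n-1))`, in shifted variables.
    have c1 : ((n : ℝ) + 2) * (n + 1).choose (M + 1) =
        (n + 2).choose (M + 2) * ((M : ℝ) + 2) := by
      exact_mod_cast Nat.add_one_mul_choose_eq (n + 1) (M + 1)
    have c2 : ((n : ℝ) + 1) * n.choose M = (n + 1).choose (M + 1) * ((M : ℝ) + 1) := by
      exact_mod_cast Nat.add_one_mul_choose_eq n M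
    simp only [Nat.add_sub_cancel, show n + 2 - 1 = n + 1 by omega,
      show M + 2 - 1 = M + 1 by omega] at hB₁ hB₂
    have hB₁' : (B₁.card : ℝ) ≤ K * (G * G) * (n + 1).choose (M + 1) := by exact_mod_cast hB₁
    have hB₂' : (B₂.card : ℝ) ≤ 2 * ((n + 2) * (((n + 1) / G : ℕ) : ℝ)) * n.choose M := by
      exact_mod_cast hB₂
    have hB : ((B₁ ∪ B₂).card : ℝ) ≤ B₁.card + B₂.card := by
      exact_mod_cast Finset.card_union_le _ _
    push_cast at hn hG1 hG2 hM0 ⊢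
    set C : ℝ := (((n + 2).choose (M + 2) : ℕ) : ℝ)
    set C₁ : ℝ := (((n + 1).choose (M + 1) : ℕ) : ℝ)
    set C₀ : ℝ := ((n.choose M : ℕ) : ℝ)
    have hC0 : 0 ≤ C := Nat.cast_nonneg _
    have hC1 : 0 ≤ C₁ := Nat.cast_nonneg _
    have hC00 : 0 ≤ C₀ := Nat.cast_nonneg _
    have hb1 : (B₁.card : ℝ) ≤ ε / 2 * C := by
      refine hB₁'.trans ?_
      have hn2 : (0 : ℝ) < n + 2 := by positivity
      refine le_of_mul_le_mul_left ?_ hn2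
      have e1 : ((n : ℝ) + 2) * (K * (G * G) * C₁) = (K * (G * G) * (M + 2)) * C := by
        rw [show ((n : ℝ) + 2) * (K * (G * G) * C₁) = K * (G * G) * ((n + 2) * C₁) by ring, c1]
        ring
      rw [e1, show ((n : ℝ) + 2) * (ε / 2 * C) = (ε / 2 * (n + 2)) * C by ring]
      refine mul_le_mul_of_nonneg_right ?_ hC0
      have e2 : (G : ℝ) * G ≤ (4 * ((M : ℝ) + 2) ^ 2 / ε) * (4 * ((M : ℝ) + 2) ^ 2 / ε) :=
        mul_le_mul hG1 hG1 hGpos'.le (by positivity)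
      calc (K : ℝ) * (G * G) * (M + 2)
          ≤ K * ((4 * ((M : ℝ) + 2) ^ 2 / ε) * (4 * ((M : ℝ) + 2) ^ 2 / ε)) * (M + 2) := by gcongr
        _ = ε / 2 * (32 * ((M : ℝ) + 2) ^ 5 * K / ε ^ 3) := by field_simp; ring
        _ ≤ ε / 2 * (n + 2) := by gcongr
    have hb2 : (B₂.card : ℝ) ≤ ε / 2 * C := by
      refine hB₂'.trans ?_
      have hd : (((n + 1) / G : ℕ) : ℝ) ≤ ((n : ℝ) + 1) / G := by
        have := Nat.cast_div_le (α := ℝ) (m := n + 1) (n := G)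
        push_cast at this
        exact this
      have e1 : 2 * (((n : ℝ) + 2) * (((n + 1) / G : ℕ) : ℝ)) * C₀ ≤
          2 * (((n : ℝ) + 2) * (((n : ℝ) + 1) / G)) * C₀ := by gcongr
      refine e1.trans ?_
      have e2 : 2 * (((n : ℝ) + 2) * (((n : ℝ) + 1) / G)) * C₀ =
          2 * (((n : ℝ) + 2) * (((n : ℝ) + 1) * C₀)) / G := by ring
      rw [e2, c2, ← mul_assoc ((n : ℝ) + 2), c1, div_le_iff₀ hGpos']
      have := mul_le_mul_of_nonneg_right hG2 hC0
      linarith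
    linarith

/-! ### Finiteness of the blow-up parameter and conclusion. -/

theorem IsSmallestForbidden.two_le {P : PermProperty} (hP : P.Hereditary)
    (hne : ∃ m : ℕ, 0 < m ∧ (P m).Nonempty) {s : ℕ} {σ : Equiv.Perm (Fin s)}
    (hσ : IsSmallestForbidden P σ) : 2 ≤ s := by
  obtain ⟨m, hm, π, hπ⟩ := hne
  by_contra hs
  have : Subsingleton (Fin s) := Fin.subsingleton_iff_le_one.2 (by omega)
  refine hσ.1 (hP _ _ _ _ hπ ⟨Fin.castLEOrderEmb (by omega), fun i j => ?_⟩)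
  rw [Subsingleton.elim i j]
  simp

/-- Append fixed points to `σ`. The result has a finite blow-up parameter, so the maximum defining
`kStar P M` is not over an empty family. -/
theorem exists_notMem_of_le {P : PermProperty} (hP : P.Hereditary) {s M : ℕ}
    {σ : Equiv.Perm (Fin s)} (hσ : σ ∉ P s) (hsM : s ≤ M) :
    ∃ α : Equiv.Perm (Fin M), α ∉ P M := by
  let g : Fin M → ℕ := fun i => if h : (i : ℕ) < s then σ ⟨i, h⟩ else i
  have hg : Function.Injective g := by
    intro i j hij
    simp only [g] at hij
    ext
    split_ifs at hij with h1 h2 h2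
    · simpa using σ.injective (Fin.ext hij)
    · have := (σ ⟨i, h1⟩).2; omega
    · have := (σ ⟨j, h2⟩).2; omega
    · exact hij
  obtain ⟨α, hα⟩ := exists_perm_lt_iff hg
  refine ⟨α, fun h => hσ (hP _ _ _ _ h ⟨Fin.castLEOrderEmb hsM, fun i j => ?_⟩)⟩
  rw [hα]
  simp [g]

theorem exists_kStarPerm_eq {P : PermProperty} {m : ℕ} {α : Equiv.Perm (Fin m)}
    (h : ¬ TesterAccepts P α) :
    ∃ k : ℕ, 0 < k ∧ ¬ HasKBlowUpIn P k α ∧ kStarPerm P α = k := by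
  classical
  have h' : ∃ k : ℕ, 0 < k ∧ ¬ HasKBlowUpIn P k α := by
    simpa [TesterAccepts] using h
  refine ⟨Nat.find h', (Nat.find_spec h').1, (Nat.find_spec h').2, le_antisymm ?_ ?_⟩
  · exact iInf₂_le (Nat.find h') (Nat.find_spec h')
  · exact le_iInf₂ fun k hk => by exact_mod_cast Nat.find_min' h' hk

theorem kStarPerm_le_kStar {P : PermProperty} {T : ℕ} {α : Equiv.Perm (Fin T)}
    (h : kStarPerm P α < ⊤) : kStarPerm P α ≤ kStar P T := by
  rw [kStar, if_pos ⟨α, h⟩]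
  exact le_iSup₂ (f := fun (α : Equiv.Perm (Fin T)) (_ : kStarPerm P α < ⊤) => kStarPerm P α) α h

theorem kStar_ne_top {P : PermProperty} {T : ℕ} {α : Equiv.Perm (Fin T)}
    (h : kStarPerm P α < ⊤) : kStar P T ≠ ⊤ := by
  rw [kStar, if_pos ⟨α, h⟩]
  -- Each finite value is at most the sum of all of them; infinite values enter this sum as `0`.
  refine ne_top_of_le_ne_top (ENat.natCast_ne_top
    (∑ β : Equiv.Perm (Fin T), (kStarPerm P β).toNat)) (iSup₂_le fun β hβ => ?_)
  rw [← ENat.natCast_toNat hβ.ne]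
  exact_mod_cast Finset.single_le_sum (f := fun β : Equiv.Perm (Fin T) => (kStarPerm P β).toNat)
    (fun _ _ => Nat.zero_le _) (Finset.mem_univ β)

theorem theorem4 (P : PermProperty) (hP : P.Hereditary)
    (hne : ∃ m : ℕ, 0 < m ∧ (P m).Nonempty)
    (s : ℕ) (σ : Equiv.Perm (Fin s)) (hσ : IsSmallestForbidden P σ)
    (ε : ℝ) (hε : 0 < ε) (hε1 : ε ≤ 1)
    (M : ℕ) (hM : 2000 * furediHajnal σ * Real.logb 2 (2 / ε) ^ 2 / ε ≤ (M : ℝ)) :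
    Tendsto (fun n : ℕ => (exNumber n σ : ℝ) / n) atTop (𝓝 (furediHajnal σ)) ∧
    s ≤ M ∧ kStar P M ≠ ⊤ ∧
    ∀ (n : ℕ) (π : Equiv.Perm (Fin n)),
      32 * (M : ℝ) ^ 5 * ((kStar P M).toNat : ℝ) / ε ^ 3 ≤ (n : ℝ) →
      (π ∈ P n → 1 - ε ≤ sampleProb M π (fun α => TesterAccepts P α)) ∧
      (ε < distToProperty earthMoverDist P π →
        1 - ε ≤ sampleProb M π (fun α => ¬ TesterAccepts P α)) ∧
      (ε < distToProperty planarTauDist P π →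
        1 - ε ≤ sampleProb M π (fun α => ¬ TesterAccepts P α)) := by
  have hs := hσ.two_le hP hne
  have hs' : (2 : ℝ) ≤ s := by exact_mod_cast hs
  have hsM : s ≤ M := by
    have h1 := sub_one_le_furediHajnal hs σ
    have h2 : 1 ≤ Real.logb 2 (2 / ε) := by
      rw [Real.le_logb_iff_rpow_le (by norm_num) (by positivity), Real.rpow_one, le_div_iff₀ hε]
      linarith
    rw [div_le_iff₀ hε] at hM
    have h3 : (M : ℝ) * ε ≤ M := mul_le_of_le_one_right (Nat.cast_nonneg _) hε1
    have h4 : 2000 * furediHajnal σ ≤ 2000 * furediHajnal σ * Real.logb 2 (2 / ε) ^ 2 :=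
      le_mul_of_one_le_right (by linarith) (one_le_pow₀ h2)
    have h5 : (s : ℝ) ≤ M := by linarith
    exact_mod_cast h5
  obtain ⟨α, hα⟩ := exists_notMem_of_le hP hσ.1 hsM
  obtain ⟨k, hk0, -, hk⟩ := exists_kStarPerm_eq fun h => hα (TesterAccepts.mem hP h)
  have hlt : kStarPerm P α < ⊤ := hk ▸ ENat.natCast_lt_top k
  have htop := kStar_ne_top hlt
  have hle : ∀ (β : Equiv.Perm (Fin M)) (k : ℕ), kStarPerm P β = k → k ≤ (kStar P M).toNat := by
    intro β k hβ
    have h := kStarPerm_le_kStar (P := P) (α := β) (hβ ▸ ENat.natCast_lt_top k)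
    rw [hβ, ← ENat.natCast_toNat htop] at h
    exact_mod_cast h
  refine ⟨tendsto_exNumber_div hs σ, hsM, htop, fun n π hn => ?_⟩
  have hMn : M ≤ n := by
    have hM1 : (1 : ℝ) ≤ M := by exact_mod_cast (by omega : 1 ≤ M)
    have hK1 : (1 : ℝ) ≤ (kStar P M).toNat := by
      exact_mod_cast hk0.trans_le (hle α k hk)
    have h1 : ε ^ 3 ≤ 1 := pow_le_one₀ hε.le hε1
    have h2 : (M : ℝ) ≤ M ^ 5 := le_self_pow₀ hM1 (by norm_num)
    have h3 : (M : ℝ) ^ 5 ≤ M ^ 5 * (kStar P M).toNat := le_mul_of_one_le_right (by positivity) hK1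
    rw [div_le_iff₀ (by positivity)] at hn
    have h4 : (n : ℝ) * ε ^ 3 ≤ n := mul_le_of_le_one_right (Nat.cast_nonneg _) h1
    have h5 : (M : ℝ) ≤ n := by linarith
    exact_mod_cast h5
  refine ⟨fun hπ => ?_, fun hd => ?_, fun hd => ?_⟩
  · refine one_sub_le_sampleProb_testerAccepts hP hε hε1 (hs.trans hsM) hMn hn (fun β hβ => ?_) hπ
    obtain ⟨k, hk0, hk, hβk⟩ := exists_kStarPerm_eq hβ
    exact ⟨k, hk0, hle β k hβk, hk⟩
  · exact one_sub_le_sampleProb_not_testerAccepts hP hs hσ.1 hε hε1 (by omega) hM (by omega) hMn π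
      fun ρ hρ => hd.trans_le (distToProperty_le earthMoverDist_nonneg hρ)
  · exact one_sub_le_sampleProb_not_testerAccepts hP hs hσ.1 hε hε1 (by omega) hM (by omega) hMn π
      fun ρ hρ => hd.trans_le (distToProperty_planarTauDist_le hρ)
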